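/- **Garside groups.** For elements $a,b$ of a monoid $M$, $a$ is a left divisor of $b$ if $b\in aM$ and a right divisor of $b$ if $b\in Ma$; a divisor is a left or right divisor, and $b$ is balanced if its left and right divisors coincide. A right lcm of $a,b$ is an $m$ having $a,b$ as left divisors and being a left divisor of every element that has $a,b$ as left divisors; left lcms are defined symmetrically, with right divisors. $M$ is Noetherian if for each $a\in M$ there is a bound on the number of factors in expressions of $a$ as a product of nonidentity elements. $M$ is Gaussian if it is Noetherian, cancellative, and every two elements have a right lcm and a left lcm. A *Garside group* is a group $G$ with a finite subset $S$ (the simple elements) and an element $\Delta$ such that the monoid $G^+$ generated by $S$ is Gaussian with group of fractions $G$, $\Delta\in G^+$ is balanced, and $S$ is the set of divisors of $\Delta$ in $G^+$. For $a,b\in G^+$ let $a\wedge b$ be their greatest common left divisor and $a\,\tilde\vee\, b$ their left lcm (least common left multiple) in $G^+$. Put $\tau(a)=\Delta^{-1}a\Delta$ and $a^g=g^{-1}ag$. For $a,b\in G$ write $a\le b$ if $b\in G^+aG^+$; let $\inf a$ be the largest $m\in\mathbb Z$ with $\Delta^m\le a$ and $\sup a$ the smallest $n\in\mathbb Z$ with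 $a\le\Delta^n$. The left normal form of $a\in G$ is $a=\Delta^{\inf a}s_1\cdots s_l$ with $s_i=\Delta\wedge(s_i\cdots s_l)\in S$ for all $i$ and $s_l\neq1$. For $a\in G^+$, $\|a\|$ is the maximal number of factors in an expression of $a$ as a product of atoms of $G^+$ (nonidentity elements that are not products of two nonidentity elements). **Tuples.** For $p,q\in\mathbb Z^r$ let $[p,q]$ be the set of $a\in G^r$ with $\Delta^{p_k}\le a_k\le\Delta^{q_k}$ for all $k=1,\dots,r$. For $a\in G^r$ and $g\in G$ let $a^g=(a_1^g,\dots,a_r^g)$ and $a^G=\{a^g: g\in G\}$. Let $e_i\in\mathbb Z^r$ be the $i$-th unit vector. **Algorithm.** For $a\in G^r$, $p,q\in\mathbb Z^r$ and $N\in\mathbb N$, $\mathrm{ConjToInterval}(a,p,q,N)$ is computed as follows. Start with $y:=1$, $c:=a$. At most $N$ times, as long as $c\notin[p,q]$, do: set $h:=1$; for $k=1,\dots,r$ successively, if $\inf c_k<p_k$ replace $h$ by $h\,\tilde\vee\,\Delta\,\tau^{-\inf c_k}\bigl(\Delta\wedge(\Delta^{-\inf c_k}c_k)\bigr)^{-1}$,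 and then, if $q_k<\sup c_k$, replace $h$ by $h\,\tilde\vee\, s$, where $s$ is the last factor in the left normal form of $c_k$; finally replace $y$ by $hy$ and $c$ by $c^{h^{-1}}=hch^{-1}$. Return $y$. **Simultaneous cyclic sliding.** For $a\in G^r$ and $p',q'\in\mathbb Z^r$ put $\mathrm{sl}(a)=x\,a\,x^{-1}$, where $x$ is the left lcm of all the elements $\tau^{-p'_j+1}(\Delta s_j^{-1})$ with $p'_j=\inf a_j+1$ and all the elements $t_j$ with $q'_j=\sup a_j-1$; here $s_j$ and $t_j$ are the first and the last factor in the left normal form of $a_j$, and the lcm of no elements is $1$. (In both constructions, a first or last factor is read as $1$ if the normal form has no factors.) **Theorem (Simultaneous Cyclic Sliding).** Let $G$ be a Garside group, $r\in\mathbb N$, $p,q\in\mathbb Z^r$ and $a\in G^r\cap[p,q]$. Let $i\in\{1,\dots,r\}$, let $(p',q')\in\{(p+e_i,q),(p,q-e_i)\}$, and assume that $a^G\cap[p',q']\neq\emptyset$. Then the element $y=\mathrm{ConjToInterval}(a,p',q',\|\Delta\|-1)$ satisfies $$a^{y^{-1}}\in[p',q'],$$ and $\|\Delta\|-1$ iterations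 of simultaneous cyclic sliding with respect to $[p',q']$ lead from $a$ into $[p',q']$: $$\mathrm{sl}^{\|\Delta\|-1}(a)\in[p',q'].$$ (If $\Delta=1$, so that $G$ is trivial, $\|\Delta\|-1$ is read as $0$.) -/

import Mathlib

namespace Garside

/-! ### Monoids -/

section Monoid

variable {M : Type*} [Monoid M]

/-- `a` is a left divisor of `b`, that is `b ∈ aM`. -/
def IsLeftDivisor (a b : M) : Prop := ∃ c, b = a * c

/-- `a` is a right divisor of `b`, that is `b ∈ Ma`. -/
def IsRightDivisor (a b : M) : Prop := ∃ c, b = c * a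

/-- The set of (left or right) divisors of `b`. -/
def divisors (b : M) : Set M := {a | IsLeftDivisor a b ∨ IsRightDivisor a b}

/-- The left and the right divisors of `b` coincide. -/
def IsBalanced (b : M) : Prop := {a | IsLeftDivisor a b} = {a | IsRightDivisor a b}

/-- An atom: a nonidentity element that is not a product of two nonidentity elements. -/
def IsMonoidAtom (a : M) : Prop := a ≠ 1 ∧ ∀ b c, a = b * c → b = 1 ∨ c = 1

/-- `m` is a right lcm of `a` and `b` (a least common right multiple). -/
def IsRightLcm (a b m : M) : Prop :=
  IsLeftDivisor a m ∧ IsLeftDivisor b m ∧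
    ∀ c, IsLeftDivisor a c → IsLeftDivisor b c → IsLeftDivisor m c

/-- `m` is a left lcm of `a` and `b` (a least common left multiple). -/
def IsLeftLcm (a b m : M) : Prop :=
  IsRightDivisor a m ∧ IsRightDivisor b m ∧
    ∀ c, IsRightDivisor a c → IsRightDivisor b c → IsRightDivisor m c

variable (M)

/-- For each `a` there is a bound on the number of factors in the expressions of `a` as a product
of nonidentity elements. -/
def IsNoetherianMonoid : Prop :=
  ∀ a : M, ∃ n : ℕ, ∀ l : List M, (∀ x ∈ l, x ≠ 1) → l.prod = a → l.length ≤ n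

/-- Gaussian monoids. -/
structure IsGaussian : Prop where
  noetherian : IsNoetherianMonoid M
  cancel : IsCancelMul M
  exists_rightLcm : ∀ a b : M, ∃ m, IsRightLcm a b m
  exists_leftLcm : ∀ a b : M, ∃ m, IsLeftLcm a b m

end Monoid

/-- The data `(S, Δ)` turning the group `G` into a Garside group: `S` is finite, the monoid `G⁺`
generated by `S` is Gaussian with group of fractions `G`, the element `Δ` of `G⁺` is balanced, and
`S` is the set of divisors of `Δ` in `G⁺`. -/
structure GarsideStructure (G : Type*) [Group G] where
  /-- the simple elements -/
  S : Set G
  /-- the Garside element -/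
  delta : G
  finite_S : S.Finite
  gaussian : IsGaussian (Submonoid.closure S)
  fractions : ∀ g : G, ∃ a ∈ Submonoid.closure S, ∃ b ∈ Submonoid.closure S, g = a * b⁻¹
  delta_mem : delta ∈ Submonoid.closure S
  balanced : IsBalanced (⟨delta, delta_mem⟩ : Submonoid.closure S)
  S_eq : S = Subtype.val '' divisors (⟨delta, delta_mem⟩ : Submonoid.closure S)

/-! ### Tuples and conjugation -/

section Tuples

variable {G : Type*} [Group G] {r : ℕ}

/-- `a ^ g = (g⁻¹ a₁ g, …, g⁻¹ a_r g)`. -/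
def conjBy (a : Fin r → G) (g : G) : Fin r → G := fun k => g⁻¹ * a k * g

/-- The simultaneous conjugacy class of the tuple `a`. -/
def conjClass (a : Fin r → G) : Set (Fin r → G) := {b | ∃ g : G, b = conjBy a g}

end Tuples

namespace GarsideStructure

variable {G : Type*} [Group G] (𝒢 : GarsideStructure G)

/-- The monoid `G⁺` generated by the simple elements. -/
def pos : Submonoid G := Submonoid.closure 𝒢.S

/-- The relation `a ≼ b` on `G`: `b ∈ a G⁺`. -/
def LeftLE (a b : G) : Prop := ∃ c ∈ 𝒢.pos, b = a * c

/-- The relation `b ≽ a` on `G`: `b ∈ G⁺ a`. -/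
def RightGE (b a : G) : Prop := ∃ c ∈ 𝒢.pos, b = c * a

/-- The relation `a ≤ b` on `G`: `b ∈ G⁺ a G⁺`. -/
def TwoSidedLE (a b : G) : Prop := ∃ c ∈ 𝒢.pos, ∃ d ∈ 𝒢.pos, b = c * a * d

/-- The automorphism `τ : a ↦ Δ⁻¹ a Δ`. -/
def tau : MulAut G := MulAut.conj 𝒢.delta⁻¹

/-- The infimum of `a`: the largest `m` with `Δ ^ m ≤ a`. -/
noncomputable def inf (a : G) : ℤ := sSup {m : ℤ | 𝒢.TwoSidedLE (𝒢.delta ^ m) a}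

/-- The supremum of `a`: the smallest `n` with `a ≤ Δ ^ n`. -/
noncomputable def sup (a : G) : ℤ := sInf {n : ℤ | 𝒢.TwoSidedLE a (𝒢.delta ^ n)}

/-- The interval `[p, q] = [p₁, q₁] × ⋯ × [p_r, q_r]` in `G ^ r`. -/
def interval {r : ℕ} (p q : Fin r → ℤ) : Set (Fin r → G) :=
  {a | ∀ k, 𝒢.TwoSidedLE (𝒢.delta ^ p k) (a k) ∧ 𝒢.TwoSidedLE (a k) (𝒢.delta ^ q k)}

/-- `d` is the greatest common left divisor in `G⁺` of the elements `a`, `b` of `G⁺`. -/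
def IsLeftGcd (a b d : G) : Prop :=
  d ∈ 𝒢.pos ∧ 𝒢.LeftLE d a ∧ 𝒢.LeftLE d b ∧
    ∀ e ∈ 𝒢.pos, 𝒢.LeftLE e a → 𝒢.LeftLE e b → 𝒢.LeftLE e d

/-- The left gcd `a ∧ b` of elements of `G⁺`. -/
noncomputable def leftGcd (a b : G) : G := Classical.epsilon (𝒢.IsLeftGcd a b)

/-- `m` is the least common left multiple in `G⁺` of the set `T` of elements of `G⁺`
(the identity if `T` is empty). -/
def IsLeftLcmOf (T : Set G) (m : G) : Prop :=
  m ∈ 𝒢.pos ∧ (∀ x ∈ T, 𝒢.RightGE m x) ∧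
    ∀ c ∈ 𝒢.pos, (∀ x ∈ T, 𝒢.RightGE c x) → 𝒢.RightGE c m

/-- The left lcm of a finite set of elements of `G⁺`. -/
noncomputable def leftLcmOf (T : Set G) : G := Classical.epsilon (𝒢.IsLeftLcmOf T)

/-- The left lcm of two elements of `G⁺`. -/
noncomputable def leftLcm (a b : G) : G := 𝒢.leftLcmOf {a, b}

/-- `l = [s₁, …, s_l]` is the left normal form of the element `a` of `G⁺`: `a = s₁ ⋯ s_l`, each
`s_i` is simple and equal to `Δ ∧ (s_i ⋯ s_l)`, and `s_l ≠ 1`. -/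
def IsNormalForm (a : G) (l : List G) : Prop :=
  l.prod = a ∧
    (∀ (i : ℕ) (hi : i < l.length),
      l[i] ∈ 𝒢.S ∧ l[i] = 𝒢.leftGcd 𝒢.delta (l.drop i).prod) ∧
    ∀ hl : l ≠ [], l.getLast hl ≠ 1

/-- The factors `s₁, …, s_l` in the left normal form `Δ ^ (inf a) s₁ ⋯ s_l` of `a ∈ G`. -/
noncomputable def normalFactors (a : G) : List G :=
  Classical.epsilon (𝒢.IsNormalForm (𝒢.delta ^ (-𝒢.inf a) * a))

/-- The first factor `s₁` of the left normal form of `a` (`1` if there is no factor). -/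
noncomputable def firstFactor (a : G) : G := (𝒢.normalFactors a).headD 1

/-- The last factor `s_l` of the left normal form of `a` (`1` if there is no factor). -/
noncomputable def lastFactor (a : G) : G := (𝒢.normalFactors a).getLastD 1

/-- The norm `‖a‖` of `a ∈ G⁺`: the maximal number of atoms of `G⁺` in an expression of `a` as a
product of atoms. -/
noncomputable def norm (a : G) : ℕ :=
  sSup {n : ℕ | ∃ l : List 𝒢.pos, (∀ x ∈ l, IsMonoidAtom x) ∧ (l.prod : G) = a ∧ l.length = n}

variable {r : ℕ}

/-! ### The algorithm -/

open Classical in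
/-- The body of the inner loop of the algorithm, for the index `k`:
the update of `h` for the tuple `c`. -/
noncomputable def innerStep (p q : Fin r → ℤ) (c : Fin r → G) (h : G) (k : Fin r) : G :=
  let h₁ := if 𝒢.inf (c k) < p k then
      𝒢.leftLcm h (𝒢.delta * ((𝒢.tau ^ (-𝒢.inf (c k)))
        (𝒢.leftGcd 𝒢.delta (𝒢.delta ^ (-𝒢.inf (c k)) * c k)))⁻¹)
    else h
  if q k < 𝒢.sup (c k) then 𝒢.leftLcm h₁ (𝒢.lastFactor (c k)) else h₁

/-- The value of `h` after the inner loop `for k := 1 to r`, started with `h = 1`. -/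
noncomputable def stepElement (p q : Fin r → ℤ) (c : Fin r → G) : G :=
  (List.finRange r).foldl (𝒢.innerStep p q c) 1

open Classical in
/-- The outer loop, with at most `n` iterations left and current values `y` and `c`: it returns `y`
as soon as `c ∈ [p, q]`, and otherwise replaces `y` by `h y` and `c` by `h c h⁻¹`. -/
noncomputable def conjLoop (p q : Fin r → ℤ) : ℕ → G → (Fin r → G) → G
  | 0, y, _ => y
  | n + 1, y, c =>
    if c ∈ 𝒢.interval p q then y
    else conjLoop p q n (𝒢.stepElement p q c * y) (conjBy c (𝒢.stepElement p q c)⁻¹)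

/-- The function `ConjToInterval(a, p, q, N)`. -/
noncomputable def conjToInterval (a : Fin r → G) (p q : Fin r → ℤ) (N : ℕ) : G :=
  𝒢.conjLoop p q N 1 a

/-! ### Simultaneous cyclic sliding -/

/-- The conjugating element of simultaneous cyclic sliding with respect to the target interval
`[p, q]`: the left lcm of the left lcm of the `τ ^ (-p_j + 1) (Δ s₁⁻¹)`, over the `j` with
`p_j = inf a_j + 1`, and of the left lcm of the last factors of the normal forms of the `a_j`, over
the `j` with `q_j = sup a_j - 1`. -/
noncomputable def slidingElement (p q : Fin r → ℤ) (a : Fin r → G) : G :=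
  𝒢.leftLcm
    (𝒢.leftLcmOf {x | ∃ j, p j = 𝒢.inf (a j) + 1 ∧
      x = (𝒢.tau ^ (-p j + 1)) (𝒢.delta * (𝒢.firstFactor (a j))⁻¹)})
    (𝒢.leftLcmOf {x | ∃ j, q j = 𝒢.sup (a j) - 1 ∧ x = 𝒢.lastFactor (a j)})

/-- Simultaneous cyclic sliding with respect to the target interval `[p, q]`. -/
noncomputable def sliding (p q : Fin r → ℤ) (a : Fin r → G) : Fin r → G :=
  conjBy a (𝒢.slidingElement p q a)⁻¹

end GarsideStructure

end Garside

namespace Garside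

/-! Order `G` by right division, writing u ⊑ v when v u⁻¹ ∈ G⁺. Finite joins exist in `G`, right
translations and left multiplication by powers of Δ are automorphisms, and [Δ⁻¹x, x] has only chains
with at most ‖Δ‖ steps, since x (Δ⁻¹x)⁻¹ = Δ.

For a target [p, q] let F(y) be the join of y, all Δ^{p_k} y a_k⁻¹ and all Δ^{-q_k} y a_k
(`ascend`). Then y a y⁻¹ ∈ [p, q] exactly when F(y) = y (`conjBy_mem_interval_iff`). F is
inflationary, preserves joins and commutes with left multiplication by Δ. A conjugate in the target,
shifted by a power of Δ, gives a fixed point above 1, so the orbit of 1 stabilizes at some x.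
Joining the orbit with the fixed point Δ⁻¹x pushes it into [Δ⁻¹x, x] without making it stop earlier,
so ‖Δ‖ - 1 steps suffice (`iterate_stable_of_bounded_chains`, `iterate_norm_fixed`).

Both procedures compute this orbit. By equivariance F(y) = h y, where h is the value at 1 of the map
F formed for c = y a y⁻¹ (`ascend_conjBy_one_mul`). As `a` misses the target by at most one, F(1) ⊑
Δ, hence F(y) ⊑ Δ y along the whole orbit and every c misses by at most one as well
(`isNear_iterate`). For such c, first and last normal form factors yield exactly the joins defining
h (`raiser_spec`, `lastFactor_spec`). -/

theorem exists_maximal_factorization {M : Type*} [Monoid M] (hM : IsNoetherianMonoid M) (w : M)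
    (l : List M) (hl : ∀ x ∈ l, x ≠ 1) (hw : l.prod = w) :
    ∃ l' : List M, (∀ x ∈ l', IsMonoidAtom x) ∧ l'.prod = w ∧ l.length ≤ l'.length := by
  obtain ⟨N, hN⟩ := hM w
  set T : Set ℕ := {n | ∃ l : List M, (∀ x ∈ l, x ≠ 1) ∧ l.prod = w ∧ l.length = n} with hT
  have hbdd : BddAbove T := ⟨N, by rintro n ⟨l, h1, h2, rfl⟩; exact hN l h1 h2⟩
  have hlT : l.length ∈ T := ⟨l, hl, hw, rfl⟩
  obtain ⟨l', h1, h2, h3⟩ := Nat.sSup_mem ⟨_, hlT⟩ hbdd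
  refine ⟨l', fun x hx => ⟨h1 x hx, fun b c hbc => ?_⟩, h2, h3 ▸ le_csSup hbdd hlT⟩
  -- In a longest factorization into nonidentity elements every factor is an atom, because splitting
  -- one would lengthen it.
  by_contra! hne
  obtain ⟨l₁, l₂, rfl⟩ := List.append_of_mem hx
  have hmem : (l₁ ++ b :: c :: l₂).length ∈ T := by
    refine ⟨_, fun y hy => ?_, ?_, rfl⟩
    · simp only [List.mem_append, List.mem_cons] at hy
      rcases hy with hy | rfl | rfl | hy
      · exact h1 y (by simp [hy])
      · exact hne.1
      · exact hne.2
      · exact h1 y (by simp [hy])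
    · rw [← h2]; simp [hbc, mul_assoc]
  have := le_csSup hbdd hmem
  rw [← h3] at this
  simp at this

namespace GarsideStructure

variable {G : Type*} [Group G] (𝒢 : GarsideStructure G)

/-! ### The positive monoid and conjugation by Δ -/

theorem delta_mem_pos : 𝒢.delta ∈ 𝒢.pos := 𝒢.delta_mem

theorem one_mem_pos : (1 : G) ∈ 𝒢.pos := 𝒢.pos.one_mem

/-- A nontrivial unit would give arbitrarily long factorizations aⁿbⁿ of 1, against Noetherianity.
-/
theorem eq_one_of_mul_eq_one {a b : G} (ha : a ∈ 𝒢.pos) (hb : b ∈ 𝒢.pos) (h : a * b = 1) :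
    a = 1 := by
  by_contra hne
  have hb1 : b ≠ 1 := by rintro rfl; exact hne (by simpa using h)
  obtain ⟨n, hn⟩ := 𝒢.gaussian.noetherian 1
  have := hn (List.replicate (n + 1) ⟨a, ha⟩ ++ List.replicate (n + 1) ⟨b, hb⟩) ?_ ?_
  · simp at this; omega
  · intro x hx
    simp only [List.mem_append, List.mem_replicate] at hx
    rcases hx with hx | hx
    · rw [hx.2]; exact fun h => hne (congrArg Subtype.val h)
    · rw [hx.2]; exact fun h => hb1 (congrArg Subtype.val h)
  · apply Subtype.ext
    have : b = a⁻¹ := (inv_eq_of_mul_eq_one_right h).symm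
    simp [this]

theorem eq_one_of_inv_mem {a : G} (ha : a ∈ 𝒢.pos) (hb : a⁻¹ ∈ 𝒢.pos) : a = 1 :=
  𝒢.eq_one_of_mul_eq_one ha hb (mul_inv_cancel a)

theorem mem_S_iff_left {s : G} : s ∈ 𝒢.S ↔ s ∈ 𝒢.pos ∧ s⁻¹ * 𝒢.delta ∈ 𝒢.pos := by
  have hbal : ∀ x, IsLeftDivisor x _ ↔ IsRightDivisor x _ := Set.ext_iff.mp 𝒢.balanced
  constructor
  · intro hs
    rw [𝒢.S_eq] at hs
    obtain ⟨x, hx, rfl⟩ := hs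
    obtain ⟨c, hc⟩ : IsLeftDivisor x _ := hx.elim id (hbal x).mpr
    refine ⟨x.2, ?_⟩
    have h2 := congrArg Subtype.val hc
    simp only [Submonoid.coe_mul] at h2
    rw [h2, inv_mul_cancel_left]
    exact c.2
  · rintro ⟨h1, h2⟩
    rw [𝒢.S_eq]
    exact ⟨⟨s, h1⟩, Or.inl ⟨⟨_, h2⟩, Subtype.ext (by simp)⟩, rfl⟩

theorem mem_S_iff_right {s : G} : s ∈ 𝒢.S ↔ s ∈ 𝒢.pos ∧ 𝒢.delta * s⁻¹ ∈ 𝒢.pos := by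
  have hbal : ∀ x, IsLeftDivisor x _ ↔ IsRightDivisor x _ := Set.ext_iff.mp 𝒢.balanced
  constructor
  · intro hs
    rw [𝒢.S_eq] at hs
    obtain ⟨x, hx, rfl⟩ := hs
    obtain ⟨c, hc⟩ : IsRightDivisor x _ := hx.elim (hbal x).mp id
    refine ⟨x.2, ?_⟩
    have h2 := congrArg Subtype.val hc
    simp only [Submonoid.coe_mul] at h2
    rw [h2, mul_inv_cancel_right]
    exact c.2
  · rintro ⟨h1, h2⟩
    rw [𝒢.S_eq]
    exact ⟨⟨s, h1⟩, Or.inr ⟨⟨_, h2⟩, Subtype.ext (by simp)⟩, rfl⟩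

/-- Since Δ is balanced, s ↦ Δ s⁻¹ maps `S` to itself; its square is conjugation by Δ. -/
theorem conj_delta_mem {a : G} (ha : a ∈ 𝒢.pos) : 𝒢.delta * a * 𝒢.delta⁻¹ ∈ 𝒢.pos := by
  induction ha using Submonoid.closure_induction with
  | mem s hs =>
    obtain ⟨h1, h2⟩ := 𝒢.mem_S_iff_right.mp hs
    have h3 : 𝒢.delta * s⁻¹ ∈ 𝒢.S := 𝒢.mem_S_iff_left.mpr ⟨h2, by simpa using h1⟩
    simpa [mul_assoc] using (𝒢.mem_S_iff_right.mp h3).2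
  | one => simp
  | mul x y _ _ hx hy => simpa [mul_assoc] using 𝒢.pos.mul_mem hx hy

theorem conj_delta_inv_mem {a : G} (ha : a ∈ 𝒢.pos) : 𝒢.delta⁻¹ * a * 𝒢.delta ∈ 𝒢.pos := by
  induction ha using Submonoid.closure_induction with
  | mem s hs =>
    obtain ⟨h1, h2⟩ := 𝒢.mem_S_iff_left.mp hs
    have h3 : s⁻¹ * 𝒢.delta ∈ 𝒢.S := 𝒢.mem_S_iff_right.mpr ⟨h2, by simpa using h1⟩
    simpa [mul_assoc] using (𝒢.mem_S_iff_left.mp h3).2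
  | one => simp
  | mul x y _ _ hx hy => simpa [mul_assoc] using 𝒢.pos.mul_mem hx hy

theorem conj_zpow_mem (n : ℤ) {a : G} (ha : a ∈ 𝒢.pos) :
    𝒢.delta ^ n * a * 𝒢.delta ^ (-n) ∈ 𝒢.pos := by
  induction n with
  | zero => simpa using ha
  | succ n ih =>
    have := 𝒢.conj_delta_mem ih
    rw [add_comm (n : ℤ) 1, neg_add_rev, zpow_add, zpow_add]
    simpa [mul_assoc] using this
  | pred n ih =>
    have := 𝒢.conj_delta_inv_mem ih
    rw [sub_eq_neg_add, neg_add_rev, zpow_add, zpow_add]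
    simpa [mul_assoc] using this

/-- Conjugation by powers of `Δ` preserves `G⁺`. -/
theorem conj_zpow_mem_iff (n : ℤ) {a : G} :
    𝒢.delta ^ n * a * 𝒢.delta ^ (-n) ∈ 𝒢.pos ↔ a ∈ 𝒢.pos := by
  refine ⟨fun h => ?_, 𝒢.conj_zpow_mem n⟩
  have := 𝒢.conj_zpow_mem (-n) h
  simpa [mul_assoc] using this

theorem zpow_mul_mem_iff (n : ℤ) {a : G} :
    𝒢.delta ^ n * a ∈ 𝒢.pos ↔ a * 𝒢.delta ^ n ∈ 𝒢.pos := by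
  rw [← 𝒢.conj_zpow_mem_iff n (a := a * 𝒢.delta ^ n)]
  simp [mul_assoc]

theorem delta_pow_mem (n : ℕ) : 𝒢.delta ^ n ∈ 𝒢.pos := 𝒢.pos.pow_mem 𝒢.delta_mem_pos n

theorem exists_inv_mul_pow_mem {b : G} (hb : b ∈ 𝒢.pos) :
    ∃ n : ℕ, b⁻¹ * 𝒢.delta ^ n ∈ 𝒢.pos := by
  induction hb using Submonoid.closure_induction with
  | mem s hs => exact ⟨1, by simpa using (𝒢.mem_S_iff_left.mp hs).2⟩
  | one => exact ⟨0, by simp⟩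
  | mul x y _ _ hx hy =>
    obtain ⟨n, hn⟩ := hx
    obtain ⟨m, hm⟩ := hy
    refine ⟨m + n, ?_⟩
    have h1 := (𝒢.conj_zpow_mem_iff (-m)).mpr hn
    have h2 := 𝒢.pos.mul_mem hm h1
    convert h2 using 1
    simp only [mul_inv_rev, pow_add, zpow_neg, zpow_natCast, neg_neg, mul_assoc]
    rw [mul_inv_cancel_left, ← pow_add, ← pow_add, add_comm]

theorem exists_mul_pow_mem (g : G) : ∃ n : ℕ, g * 𝒢.delta ^ n ∈ 𝒢.pos := by
  obtain ⟨a, ha, b, hb, rfl⟩ := 𝒢.fractions g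
  obtain ⟨n, hn⟩ := 𝒢.exists_inv_mul_pow_mem hb
  exact ⟨n, by simpa [mul_assoc] using 𝒢.pos.mul_mem ha hn⟩

theorem mul_pow_mem_of_le {g : G} {m n : ℕ} (h : m ≤ n) (hg : g * 𝒢.delta ^ m ∈ 𝒢.pos) :
    g * 𝒢.delta ^ n ∈ 𝒢.pos := by
  obtain ⟨k, rfl⟩ := Nat.exists_eq_add_of_le h
  rw [pow_add, ← mul_assoc]
  exact 𝒢.pos.mul_mem hg (𝒢.delta_pow_mem k)

/-! ### The two orders on `G` -/

theorem rightGE_iff {a b : G} : 𝒢.RightGE b a ↔ b * a⁻¹ ∈ 𝒢.pos := by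
  constructor
  · rintro ⟨c, hc, rfl⟩; simpa using hc
  · intro h; exact ⟨_, h, by simp⟩

theorem leftLE_iff {a b : G} : 𝒢.LeftLE a b ↔ a⁻¹ * b ∈ 𝒢.pos := by
  constructor
  · rintro ⟨c, hc, rfl⟩; simpa using hc
  · intro h; exact ⟨_, h, by simp⟩

theorem rightGE_refl (a : G) : 𝒢.RightGE a a := ⟨1, 𝒢.one_mem_pos, by simp⟩

theorem rightGE_one {a : G} : 𝒢.RightGE a 1 ↔ a ∈ 𝒢.pos := by simp [rightGE_iff]

variable {𝒢}

theorem RightGE.trans {a b c : G} (h : 𝒢.RightGE a b) (h' : 𝒢.RightGE b c) : 𝒢.RightGE a c := by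
  rw [rightGE_iff] at *
  simpa [mul_assoc] using 𝒢.pos.mul_mem h h'

theorem RightGE.antisymm {a b : G} (h : 𝒢.RightGE a b) (h' : 𝒢.RightGE b a) : a = b := by
  rw [rightGE_iff] at *
  exact mul_inv_eq_one.mp (𝒢.eq_one_of_inv_mem h (by simpa using h'))

theorem RightGE.mem_pos {a b : G} (h : 𝒢.RightGE a b) (hb : b ∈ 𝒢.pos) : a ∈ 𝒢.pos :=
  𝒢.rightGE_one.mp (h.trans (𝒢.rightGE_one.mpr hb))

theorem eq_of_forall_rightGE_iff {a b : G} (h : ∀ w, 𝒢.RightGE w a ↔ 𝒢.RightGE w b) : a = b :=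
  ((h b).mpr (𝒢.rightGE_refl b)).antisymm ((h a).mp (𝒢.rightGE_refl a)) |>.symm

theorem LeftLE.antisymm {a b : G} (h : 𝒢.LeftLE a b) (h' : 𝒢.LeftLE b a) : a = b := by
  rw [leftLE_iff] at *
  exact inv_mul_eq_one.mp (𝒢.eq_one_of_inv_mem h (by simpa using h'))

variable (𝒢)

theorem mul_rightGE_mul {a b : G} (g : G) : 𝒢.RightGE (b * g) (a * g) ↔ 𝒢.RightGE b a := by
  simp [rightGE_iff, mul_assoc]

theorem zpow_mul_rightGE {a b : G} (n : ℤ) :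
    𝒢.RightGE (𝒢.delta ^ n * b) (𝒢.delta ^ n * a) ↔ 𝒢.RightGE b a := by
  rw [rightGE_iff, rightGE_iff, ← 𝒢.conj_zpow_mem_iff n (a := b * a⁻¹)]
  simp [mul_assoc]

theorem rightGE_zpow_mul {a w : G} (n : ℤ) (g : G) :
    𝒢.RightGE w (𝒢.delta ^ n * a * g) ↔ 𝒢.RightGE (𝒢.delta ^ (-n) * w * g⁻¹) a := by
  rw [← 𝒢.mul_rightGE_mul g⁻¹, ← 𝒢.zpow_mul_rightGE (-n)]
  simp [mul_assoc]

/-! ### Joins and meets -/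

theorem exists_lub_pair (u v : G) :
    ∃ m, ∀ w, 𝒢.RightGE w m ↔ 𝒢.RightGE w u ∧ 𝒢.RightGE w v := by
  obtain ⟨n₁, h₁⟩ := 𝒢.exists_mul_pow_mem u
  obtain ⟨n₂, h₂⟩ := 𝒢.exists_mul_pow_mem v
  have hu := 𝒢.mul_pow_mem_of_le (le_max_left n₁ n₂) h₁
  have hv := 𝒢.mul_pow_mem_of_le (le_max_right n₁ n₂) h₂
  -- Right translation preserves the order, so a common power of Δ carries both elements into G⁺,
  -- where left lcms exist.
  set d := 𝒢.delta ^ max n₁ n₂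
  have key : ∀ x y : Submonoid.closure 𝒢.S, IsRightDivisor x y ↔ 𝒢.RightGE (y : G) x := by
    intro x y
    constructor
    · rintro ⟨c, rfl⟩; exact ⟨c, c.2, rfl⟩
    · rintro ⟨c, hc, h⟩; exact ⟨⟨c, hc⟩, Subtype.ext h⟩
  obtain ⟨m, hm₁, hm₂, hm⟩ := 𝒢.gaussian.exists_leftLcm ⟨_, hu⟩ ⟨_, hv⟩
  rw [key] at hm₁ hm₂
  have hmd : 𝒢.RightGE (m * d⁻¹ * d) m := by simpa using 𝒢.rightGE_refl (m : G)
  refine ⟨m * d⁻¹, fun w => ⟨fun h => ?_, fun ⟨h, h'⟩ => ?_⟩⟩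
  · have hw := ((𝒢.mul_rightGE_mul d).mpr h).trans hmd
    exact ⟨(𝒢.mul_rightGE_mul d).mp (hw.trans hm₁), (𝒢.mul_rightGE_mul d).mp (hw.trans hm₂)⟩
  · rw [← 𝒢.mul_rightGE_mul d] at h h' ⊢
    have := hm ⟨w * d, h.mem_pos hu⟩ ((key _ _).mpr h) ((key _ _).mpr h')
    simpa using (key _ _).mp this

theorem exists_lub {T : Set G} (hT : T.Finite) (u : G) :
    ∃ m, ∀ w, 𝒢.RightGE w m ↔ 𝒢.RightGE w u ∧ ∀ x ∈ T, 𝒢.RightGE w x := by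
  induction T, hT using Set.Finite.induction_on with
  | empty => exact ⟨u, by simp⟩
  | @insert x T _ _ ih =>
    obtain ⟨m, hm⟩ := ih
    obtain ⟨m', hm'⟩ := 𝒢.exists_lub_pair m x
    refine ⟨m', fun w => ?_⟩
    rw [hm', hm]
    simp only [Set.mem_insert_iff, forall_eq_or_imp]
    tauto

/-- Inversion turns the order by right division into the reverse of the order by left division. -/
theorem exists_left_glb (u v : G) :
    ∃ d, ∀ e, 𝒢.LeftLE e d ↔ 𝒢.LeftLE e u ∧ 𝒢.LeftLE e v := by
  obtain ⟨m, hm⟩ := 𝒢.exists_lub_pair u⁻¹ v⁻¹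
  refine ⟨m⁻¹, fun e => ?_⟩
  simpa [rightGE_iff, leftLE_iff] using hm e⁻¹

theorem leftLE_one {a : G} : 𝒢.LeftLE 1 a ↔ a ∈ 𝒢.pos := by simp [leftLE_iff]

/-- The gcd in G⁺ is a greatest lower bound in all of `G`; it is later tested against elements `e`
that need not be positive. -/
theorem leftLE_leftGcd {u v : G} (hu : u ∈ 𝒢.pos) (hv : v ∈ 𝒢.pos) (e : G) :
    𝒢.LeftLE e (𝒢.leftGcd u v) ↔ 𝒢.LeftLE e u ∧ 𝒢.LeftLE e v := by
  obtain ⟨d, hd⟩ := 𝒢.exists_left_glb u v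
  have hd' := (hd d).mp ⟨1, 𝒢.one_mem_pos, by simp⟩
  have hgcd : 𝒢.IsLeftGcd u v d :=
    ⟨𝒢.leftLE_one.mp ((hd 1).mpr ⟨𝒢.leftLE_one.mpr hu, 𝒢.leftLE_one.mpr hv⟩), hd'.1, hd'.2,
      fun e _ h h' => (hd e).mpr ⟨h, h'⟩⟩
  have hg : 𝒢.IsLeftGcd u v (𝒢.leftGcd u v) := Classical.epsilon_spec ⟨d, hgcd⟩
  have : 𝒢.leftGcd u v = d :=
    ((hd _).mpr ⟨hg.2.1, hg.2.2.1⟩).antisymm (hg.2.2.2 d hgcd.1 hd'.1 hd'.2)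
  rw [this, hd]

theorem leftGcd_mem {u v : G} (hu : u ∈ 𝒢.pos) (hv : v ∈ 𝒢.pos) : 𝒢.leftGcd u v ∈ 𝒢.pos :=
  𝒢.leftLE_one.mp ((𝒢.leftLE_leftGcd hu hv 1).mpr ⟨𝒢.leftLE_one.mpr hu, 𝒢.leftLE_one.mpr hv⟩)

/-- Positivity of `w` must be assumed because `T` may be empty, with lcm 1. -/
theorem leftLcmOf_spec {T : Set G} (hT : T.Finite) :
    𝒢.leftLcmOf T ∈ 𝒢.pos ∧
      ∀ w ∈ 𝒢.pos, 𝒢.RightGE w (𝒢.leftLcmOf T) ↔ ∀ x ∈ T, 𝒢.RightGE w x := by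
  obtain ⟨m, hm⟩ := 𝒢.exists_lub hT 1
  have hm' := (hm m).mp (𝒢.rightGE_refl m)
  have hlcm : 𝒢.IsLeftLcmOf T m := ⟨𝒢.rightGE_one.mp hm'.1, hm'.2,
    fun c hc h => (hm c).mpr ⟨𝒢.rightGE_one.mpr hc, h⟩⟩
  have hl : 𝒢.IsLeftLcmOf T (𝒢.leftLcmOf T) := Classical.epsilon_spec ⟨m, hlcm⟩
  exact ⟨hl.1, fun w hw => ⟨fun h x hx => h.trans (hl.2.1 x hx), hl.2.2 w hw⟩⟩

theorem leftLcm_spec {u v : G} (hu : u ∈ 𝒢.pos) :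
    𝒢.leftLcm u v ∈ 𝒢.pos ∧
      ∀ w, 𝒢.RightGE w (𝒢.leftLcm u v) ↔ 𝒢.RightGE w u ∧ 𝒢.RightGE w v := by
  obtain ⟨h, h'⟩ := 𝒢.leftLcmOf_spec (Set.toFinite {u, v})
  refine ⟨h, fun w => ⟨fun hw => ?_, fun hw => ?_⟩⟩
  · simpa using (h' w (hw.mem_pos h)).mp hw
  · exact (h' w (hw.1.mem_pos hu)).mpr (by simpa using hw)

/-! ### Infimum and supremum -/

theorem twoSidedLE_zpow_left {n : ℤ} {a : G} :
    𝒢.TwoSidedLE (𝒢.delta ^ n) a ↔ a * 𝒢.delta ^ (-n) ∈ 𝒢.pos := by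
  constructor
  · rintro ⟨c, hc, d, hd, rfl⟩
    simpa [mul_assoc] using 𝒢.pos.mul_mem hc (𝒢.conj_zpow_mem n hd)
  · intro h
    exact ⟨_, h, 1, 𝒢.one_mem_pos, by simp⟩

theorem twoSidedLE_zpow_right {n : ℤ} {a : G} :
    𝒢.TwoSidedLE a (𝒢.delta ^ n) ↔ a⁻¹ * 𝒢.delta ^ n ∈ 𝒢.pos := by
  constructor
  · rintro ⟨c, hc, d, hd, h⟩
    have h1 := 𝒢.conj_zpow_mem (-n) hc
    have h2 := 𝒢.pos.mul_mem hd h1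
    convert h2 using 1
    have : a = c⁻¹ * 𝒢.delta ^ n * d⁻¹ := by rw [h]; group
    rw [this]; group
  · intro h
    exact ⟨1, 𝒢.one_mem_pos, _, h, by simp⟩

theorem nonneg_of_zpow_mem (hΔ : 𝒢.delta ≠ 1) {n : ℤ} (h : 𝒢.delta ^ n ∈ 𝒢.pos) : 0 ≤ n := by
  by_contra! hn
  obtain ⟨k, rfl⟩ : ∃ k : ℕ, n = -(k + 1 : ℕ) := ⟨(-n - 1).toNat, by omega⟩
  rw [zpow_neg, zpow_natCast] at h
  refine hΔ (𝒢.eq_one_of_mul_eq_one 𝒢.delta_mem_pos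
    (𝒢.pos.mul_mem (𝒢.delta_pow_mem k) h) ?_)
  rw [← mul_assoc, ← pow_succ', mul_inv_cancel]

theorem twoSidedLE_zpow_zpow (hΔ : 𝒢.delta ≠ 1) {m n : ℤ} {a : G}
    (h : 𝒢.TwoSidedLE (𝒢.delta ^ m) a) (h' : 𝒢.TwoSidedLE a (𝒢.delta ^ n)) : m ≤ n := by
  rw [twoSidedLE_zpow_left] at h
  rw [twoSidedLE_zpow_right, ← 𝒢.zpow_mul_mem_iff] at h'
  have := 𝒢.pos.mul_mem h' h
  rw [mul_assoc, inv_mul_cancel_left, ← zpow_add] at this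
  have := 𝒢.nonneg_of_zpow_mem hΔ this
  omega

theorem exists_zpow_twoSidedLE (a : G) : ∃ m : ℤ, 𝒢.TwoSidedLE (𝒢.delta ^ m) a := by
  obtain ⟨n, hn⟩ := 𝒢.exists_mul_pow_mem a
  exact ⟨-n, by rw [twoSidedLE_zpow_left]; simpa using hn⟩

theorem exists_twoSidedLE_zpow (a : G) : ∃ m : ℤ, 𝒢.TwoSidedLE a (𝒢.delta ^ m) := by
  obtain ⟨n, hn⟩ := 𝒢.exists_mul_pow_mem a⁻¹
  exact ⟨n, by rw [twoSidedLE_zpow_right]; simpa using hn⟩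

/-- For Δ ≠ 1 the set of exponents is bounded, so its supremum in ℤ is attained; it is closed
downwards as Δ is positive. -/
theorem le_inf_iff (hΔ : 𝒢.delta ≠ 1) {m : ℤ} {a : G} :
    m ≤ 𝒢.inf a ↔ 𝒢.TwoSidedLE (𝒢.delta ^ m) a := by
  obtain ⟨n, hn⟩ := 𝒢.exists_twoSidedLE_zpow a
  have hb : BddAbove {m : ℤ | 𝒢.TwoSidedLE (𝒢.delta ^ m) a} :=
    ⟨n, fun m hm => 𝒢.twoSidedLE_zpow_zpow hΔ hm hn⟩
  refine ⟨fun h => ?_, fun h => le_csSup hb h⟩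
  have h1 : 𝒢.TwoSidedLE (𝒢.delta ^ 𝒢.inf a) a := Int.csSup_mem (𝒢.exists_zpow_twoSidedLE a) hb
  rw [twoSidedLE_zpow_left] at *
  obtain ⟨k, hk⟩ := Int.le.dest h
  have := 𝒢.pos.mul_mem h1 (𝒢.delta_pow_mem k)
  rwa [mul_assoc, ← zpow_natCast, ← zpow_add, show -𝒢.inf a + k = -m by omega] at this

theorem sup_le_iff (hΔ : 𝒢.delta ≠ 1) {n : ℤ} {a : G} :
    𝒢.sup a ≤ n ↔ 𝒢.TwoSidedLE a (𝒢.delta ^ n) := by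
  obtain ⟨m, hm⟩ := 𝒢.exists_zpow_twoSidedLE a
  have hb : BddBelow {n : ℤ | 𝒢.TwoSidedLE a (𝒢.delta ^ n)} :=
    ⟨m, fun n hn => 𝒢.twoSidedLE_zpow_zpow hΔ hm hn⟩
  refine ⟨fun h => ?_, fun h => csInf_le hb h⟩
  have h1 : 𝒢.TwoSidedLE a (𝒢.delta ^ 𝒢.sup a) := Int.csInf_mem (𝒢.exists_twoSidedLE_zpow a) hb
  rw [twoSidedLE_zpow_right] at *
  obtain ⟨k, hk⟩ := Int.le.dest h
  have := 𝒢.pos.mul_mem h1 (𝒢.delta_pow_mem k)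
  rwa [mul_assoc, ← zpow_natCast, ← zpow_add, hk] at this

theorem sup_zpow (hΔ : 𝒢.delta ≠ 1) (n : ℤ) : 𝒢.sup (𝒢.delta ^ n) = n := by
  refine eq_of_forall_ge_iff fun m => ?_
  rw [𝒢.sup_le_iff hΔ, twoSidedLE_zpow_right, ← zpow_neg, ← zpow_add]
  refine ⟨fun h => by have := 𝒢.nonneg_of_zpow_mem hΔ h; omega, fun h => ?_⟩
  obtain ⟨k, rfl⟩ := Int.le.dest h
  simpa using 𝒢.delta_pow_mem k

theorem sup_mul_le (hΔ : 𝒢.delta ≠ 1) (a b : G) : 𝒢.sup (a * b) ≤ 𝒢.sup a + 𝒢.sup b := by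
  have ha := (𝒢.sup_le_iff hΔ).mp (le_refl (𝒢.sup a))
  have hb := (𝒢.sup_le_iff hΔ).mp (le_refl (𝒢.sup b))
  rw [𝒢.sup_le_iff hΔ, twoSidedLE_zpow_right] at *
  have h := 𝒢.pos.mul_mem hb (𝒢.conj_zpow_mem (-𝒢.sup b) ha)
  convert h using 1
  group

theorem sup_pow_le (hΔ : 𝒢.delta ≠ 1) (a : G) (n : ℕ) : 𝒢.sup (a ^ n) ≤ n * 𝒢.sup a := by
  induction n with
  | zero => simpa using (𝒢.sup_zpow hΔ 0).le
  | succ n ih =>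
    rw [pow_succ]
    have := 𝒢.sup_mul_le hΔ (a ^ n) a
    push_cast
    linarith

/-- The supremum of a conjugate of `Δ ^ n` is at least `n`. -/
theorem le_sup_conj_zpow (hΔ : 𝒢.delta ≠ 1) (y : G) (n : ℤ) :
    n ≤ 𝒢.sup (y * 𝒢.delta ^ n * y⁻¹) := by
  by_contra! hlt
  set w := y * 𝒢.delta ^ n * y⁻¹
  set k := (𝒢.sup y⁻¹ + 𝒢.sup y).toNat + 1 with hk
  have h1 : y⁻¹ * w ^ k * y = 𝒢.delta ^ (n * k) := by
    rw [conj_pow, zpow_mul, zpow_natCast]; group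
  have h2 := 𝒢.sup_mul_le hΔ (y⁻¹ * w ^ k) y
  have h3 := 𝒢.sup_mul_le hΔ y⁻¹ (w ^ k)
  have h4 := 𝒢.sup_pow_le hΔ w k
  rw [h1, 𝒢.sup_zpow hΔ] at h2
  have h5 : (k : ℤ) * 𝒢.sup w ≤ k * (n - 1) := by gcongr; omega
  have h6 : 𝒢.sup y⁻¹ + 𝒢.sup y < k := by omega
  nlinarith

/-! ### The norm -/

theorem length_le_norm (l : List 𝒢.pos) (hl : ∀ x ∈ l, x ≠ 1) :
    l.length ≤ 𝒢.norm (l.prod : 𝒢.pos) := by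
  obtain ⟨l', h1, h2, h3⟩ := exists_maximal_factorization 𝒢.gaussian.noetherian _ l hl rfl
  obtain ⟨N, hN⟩ := 𝒢.gaussian.noetherian l.prod
  refine h3.trans (le_csSup ⟨N, ?_⟩ ⟨l', h1, congrArg Subtype.val h2, rfl⟩)
  rintro n ⟨l₁, h, h', rfl⟩
  exact hN l₁ (fun x hx => (h x hx).1) (Subtype.ext h')

/-- A strictly increasing chain below `x` has at most `‖x u₀⁻¹‖` steps. -/
theorem chain_length_le_norm {u : ℕ → G} {n : ℕ} {x : G}
    (hu : ∀ i < n, 𝒢.RightGE (u (i + 1)) (u i) ∧ u i ≠ u (i + 1)) (hx : 𝒢.RightGE x (u n)) :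
    n ≤ 𝒢.norm (x * (u 0)⁻¹) := by
  have key : ∃ l : List 𝒢.pos, (∀ x ∈ l, x ≠ 1) ∧ (l.prod : G) = u n * (u 0)⁻¹ ∧ l.length = n := by
    clear hx
    induction n with
    | zero => exact ⟨[], by simp⟩
    | succ n ih =>
      obtain ⟨l, h1, h2, h3⟩ := ih fun i hi => hu i (by omega)
      obtain ⟨hge, hne⟩ := hu n (by omega)
      rw [rightGE_iff] at hge
      refine ⟨⟨_, hge⟩ :: l, ?_, by simp [h2, mul_assoc], by simp [h3]⟩
      intro y hy
      rcases List.mem_cons.mp hy with rfl | hy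
      · intro h
        exact hne (mul_inv_eq_one.mp (congrArg Subtype.val h)).symm
      · exact h1 y hy
  obtain ⟨l, h1, h2, h3⟩ := key
  rw [rightGE_iff] at hx
  have hprod : x * (u 0)⁻¹ = x * (u n)⁻¹ * (u n * (u 0)⁻¹) := by group
  by_cases h : x * (u n)⁻¹ = 1
  · rw [hprod, h, one_mul, ← h2, ← h3]
    exact 𝒢.length_le_norm l h1
  · have := 𝒢.length_le_norm (⟨_, hx⟩ :: l) (by
      intro y hy
      rcases List.mem_cons.mp hy with rfl | hy
      · exact fun h' => h (congrArg Subtype.val h')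
      · exact h1 y hy)
    rw [List.prod_cons, Submonoid.coe_mul, h2] at this
    rw [hprod]
    simp only [List.length_cons, h3] at this
    omega

end GarsideStructure
end Garside

namespace Garside
namespace GarsideStructure

variable {G : Type*} [Group G] (𝒢 : GarsideStructure G)

/-! ### Normal forms -/

theorem exists_simple_leftLE {b : G} (hb : b ∈ 𝒢.pos) (hne : b ≠ 1) :
    ∃ s ∈ 𝒢.S, s ≠ 1 ∧ 𝒢.LeftLE s b := by
  induction hb using Submonoid.closure_induction with
  | mem s hs => exact ⟨s, hs, hne, 1, 𝒢.one_mem_pos, by simp⟩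
  | one => exact absurd rfl hne
  | mul x y hx' hy' hx hy =>
    by_cases h : x = 1
    · subst h
      simpa using hy (by simpa using hne)
    · obtain ⟨s, hs, hs1, c, hc, rfl⟩ := hx h
      exact ⟨s, hs, hs1, c * y, 𝒢.pos.mul_mem hc hy', by simp [mul_assoc]⟩

theorem leftGcd_delta_spec {b : G} (hb : b ∈ 𝒢.pos) :
    𝒢.leftGcd 𝒢.delta b ∈ 𝒢.S ∧ (𝒢.leftGcd 𝒢.delta b)⁻¹ * b ∈ 𝒢.pos := by
  have h := (𝒢.leftLE_leftGcd 𝒢.delta_mem_pos hb (𝒢.leftGcd 𝒢.delta b)).mp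
    ⟨1, 𝒢.one_mem_pos, by simp⟩
  rw [leftLE_iff, leftLE_iff] at h
  exact ⟨𝒢.mem_S_iff_left.mpr ⟨𝒢.leftGcd_mem 𝒢.delta_mem_pos hb, h.1⟩, h.2⟩

theorem leftGcd_delta_ne_one {b : G} (hb : b ∈ 𝒢.pos) (hne : b ≠ 1) :
    𝒢.leftGcd 𝒢.delta b ≠ 1 := by
  obtain ⟨s, hs, hs1, hsb⟩ := 𝒢.exists_simple_leftLE hb hne
  obtain ⟨hs2, hs3⟩ := 𝒢.mem_S_iff_left.mp hs
  intro h
  have := (𝒢.leftLE_leftGcd 𝒢.delta_mem_pos hb s).mpr ⟨𝒢.leftLE_iff.mpr hs3, hsb⟩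
  rw [h, leftLE_iff, mul_one] at this
  exact hs1 (𝒢.eq_one_of_inv_mem hs2 this)

theorem IsNormalForm.tail {𝒢 : GarsideStructure G} {b s : G} {l : List G}
    (h : 𝒢.IsNormalForm b (s :: l)) : 𝒢.IsNormalForm l.prod l := by
  refine ⟨rfl, fun i hi => ?_, fun hl => ?_⟩
  · have := h.2.1 (i + 1) (by simpa using hi)
    rwa [List.getElem_cons_succ, List.drop_succ_cons] at this
  · simpa [List.getLast_cons hl] using h.2.2 (by simp)

theorem IsNormalForm.head_eq {𝒢 : GarsideStructure G} {b s : G} {l : List G}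
    (h : 𝒢.IsNormalForm b (s :: l)) : s ∈ 𝒢.S ∧ s = 𝒢.leftGcd 𝒢.delta b := by
  have := h.2.1 0 (by simp)
  rw [← h.1]
  simpa using this

theorem IsNormalForm.mem_S {𝒢 : GarsideStructure G} {b : G} {l : List G}
    (h : 𝒢.IsNormalForm b l) : ∀ s ∈ l, s ∈ 𝒢.S := by
  intro s hs
  obtain ⟨i, hi, rfl⟩ := List.mem_iff_getElem.mp hs
  exact (h.2.1 i hi).1

theorem list_prod_mem_pos {l : List G} (h : ∀ s ∈ l, s ∈ 𝒢.S) : l.prod ∈ 𝒢.pos :=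
  𝒢.pos.list_prod_mem fun s hs => Submonoid.subset_closure (h s hs)

theorem inv_list_prod_mul_pow_mem {l : List G} (h : ∀ s ∈ l, s ∈ 𝒢.S) :
    l.prod⁻¹ * 𝒢.delta ^ l.length ∈ 𝒢.pos := by
  induction l with
  | nil => simp
  | cons s l ih =>
    have h1 := (𝒢.mem_S_iff_left.mp (h s (by simp))).2
    have h2 := ih fun t ht => h t (by simp [ht])
    convert 𝒢.pos.mul_mem h2 (𝒢.conj_zpow_mem (-l.length) h1) using 1
    simp [mul_assoc, pow_succ']

theorem exists_isNormalForm {b : G} (hb : b ∈ 𝒢.pos) : ∃ l, 𝒢.IsNormalForm b l := by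
  obtain ⟨n, hn⟩ := 𝒢.gaussian.noetherian ⟨b, hb⟩
  replace hn : ∀ l : List 𝒢.pos, (∀ x ∈ l, x ≠ 1) → (l.prod : G) = b → l.length ≤ n :=
    fun l h h' => hn l h (Subtype.ext h')
  induction n generalizing b with
  | zero =>
    by_cases h : b = 1
    · exact ⟨[], h.symm, fun i hi => absurd hi (by simp), fun hl => absurd rfl hl⟩
    · have := hn [⟨b, hb⟩] (List.forall_mem_singleton.mpr fun e => h (congrArg Subtype.val e))
        (by rw [List.prod_singleton])
      simp at this
  | succ n ih =>
    by_cases h : b = 1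
    · exact ⟨[], h.symm, fun i hi => absurd hi (by simp), fun hl => absurd rfl hl⟩
    obtain ⟨hs, hc⟩ := 𝒢.leftGcd_delta_spec hb
    have hs1 := 𝒢.leftGcd_delta_ne_one hb h
    obtain ⟨l, hl⟩ := ih hc fun l h h' => by
      have := hn (⟨_, 𝒢.leftGcd_mem 𝒢.delta_mem_pos hb⟩ :: l)
        (List.forall_mem_cons.mpr ⟨fun e => hs1 (congrArg Subtype.val e), h⟩)
        (by rw [List.prod_cons, Submonoid.coe_mul, h', mul_inv_cancel_left])
      simpa using this
    have hp : 𝒢.leftGcd 𝒢.delta b * l.prod = b := by simp [hl.1]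
    refine ⟨𝒢.leftGcd 𝒢.delta b :: l, by simpa using hp, fun i hi => ?_, fun _ => ?_⟩
    · cases i with
      | zero => simpa [hp] using hs
      | succ i =>
        rw [List.getElem_cons_succ, List.drop_succ_cons]
        exact hl.2.1 i (by simpa using hi)
    · rcases eq_or_ne l [] with rfl | hne
      · simpa using hs1
      · simpa [List.getLast_cons hne] using hl.2.2 hne

/-- The product of the first `k` factors of a normal form of `b` is the left gcd of `b` and
`Δ ^ k`. -/
theorem IsNormalForm.leftLE_prod_take {𝒢 : GarsideStructure G} {b : G} {l : List G}
    (h : 𝒢.IsNormalForm b l) (k : ℕ) {d : G} (hd : 𝒢.LeftLE d b)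
    (hd' : 𝒢.LeftLE d (𝒢.delta ^ k)) : 𝒢.LeftLE d (l.take k).prod := by
  induction k generalizing b l d with
  | zero => simpa using hd'
  | succ k ih =>
    cases l with
    | nil => simpa [h.1] using hd
    | cons s l =>
      have hb : b ∈ 𝒢.pos := h.1 ▸ 𝒢.list_prod_mem_pos h.mem_S
      have hlp : l.prod ∈ 𝒢.pos := 𝒢.list_prod_mem_pos h.tail.mem_S
      have hbs : b = s * l.prod := by rw [← h.1]; simp
      have key : 𝒢.LeftLE (s⁻¹ * d) (𝒢.delta ^ k) := by
        -- The element d Δ^{-k} left-divides both Δ and b, hence also their gcd s; moving Δ^k across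
        -- gives s⁻¹ d ≼ Δ^k.
        have h1 : 𝒢.LeftLE (d * 𝒢.delta ^ (-(k : ℤ))) s := by
          rw [h.head_eq.2, 𝒢.leftLE_leftGcd 𝒢.delta_mem_pos hb]
          simp only [leftLE_iff] at hd hd' ⊢
          constructor
          · convert 𝒢.conj_zpow_mem k hd' using 1
            rw [← zpow_natCast]
            push_cast
            group
          · have := 𝒢.pos.mul_mem (𝒢.delta_pow_mem k) hd
            simpa [mul_assoc] using this
        rw [leftLE_iff] at h1 ⊢
        rw [← 𝒢.conj_zpow_mem_iff k]
        simpa [mul_assoc] using h1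
      have h2 := ih h.tail (d := s⁻¹ * d) (by
        rw [leftLE_iff] at hd ⊢; simpa [hbs, mul_assoc] using hd) key
      rw [leftLE_iff] at h2 ⊢
      simpa [mul_assoc] using h2

/-! ### First and last factors -/

theorem zpow_neg_inf_mul_mem (hΔ : 𝒢.delta ≠ 1) (a : G) :
    𝒢.delta ^ (-𝒢.inf a) * a ∈ 𝒢.pos := by
  rw [𝒢.zpow_mul_mem_iff, ← 𝒢.twoSidedLE_zpow_left]
  exact (𝒢.le_inf_iff hΔ).mp le_rfl

theorem normalFactors_spec (hΔ : 𝒢.delta ≠ 1) (a : G) :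
    𝒢.IsNormalForm (𝒢.delta ^ (-𝒢.inf a) * a) (𝒢.normalFactors a) :=
  Classical.epsilon_spec (𝒢.exists_isNormalForm (𝒢.zpow_neg_inf_mul_mem hΔ a))

theorem firstFactor_eq (hΔ : 𝒢.delta ≠ 1) (a : G) :
    𝒢.firstFactor a = 𝒢.leftGcd 𝒢.delta (𝒢.delta ^ (-𝒢.inf a) * a) := by
  have h := 𝒢.normalFactors_spec hΔ a
  have hb := 𝒢.zpow_neg_inf_mul_mem hΔ a
  rw [firstFactor]
  cases hl : 𝒢.normalFactors a with
  | nil =>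
    rw [hl] at h
    have h1 : 𝒢.delta ^ (-𝒢.inf a) * a = 1 := by simpa using h.1.symm
    have h2 := (𝒢.leftGcd_delta_spec hb).2
    rw [h1] at h2 ⊢
    rw [mul_one] at h2
    exact (𝒢.eq_one_of_inv_mem (𝒢.leftGcd_mem 𝒢.delta_mem_pos 𝒢.one_mem_pos) h2).symm
  | cons s l =>
    rw [hl] at h
    exact h.head_eq.2

theorem tau_zpow_apply (n : ℤ) (x : G) :
    (𝒢.tau ^ n) x = 𝒢.delta ^ (-n) * x * 𝒢.delta ^ n := by
  rw [tau, ← map_zpow, MulAut.conj_apply]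
  simp

/-- The element by which `a` has to be conjugated from the left to raise its infimum. -/
noncomputable def raiser (a : G) : G :=
  𝒢.delta * ((𝒢.tau ^ (-𝒢.inf a)) (𝒢.leftGcd 𝒢.delta (𝒢.delta ^ (-𝒢.inf a) * a)))⁻¹

theorem raiser_eq_tau (hΔ : 𝒢.delta ≠ 1) (a : G) :
    𝒢.raiser a = (𝒢.tau ^ (-𝒢.inf a)) (𝒢.delta * (𝒢.firstFactor a)⁻¹) := by
  rw [raiser, map_mul, map_inv, 𝒢.firstFactor_eq hΔ, 𝒢.tau_zpow_apply _ 𝒢.delta]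
  congr 1
  group

/-- The raiser is the join of 1 and Δ^{m+1} a⁻¹, where m = inf a: the map w ↦ Δ^{-m} w⁻¹ Δ^{m+1}
exchanges this join with the meet of Δ and Δ^{-m} a. -/
theorem raiser_spec (hΔ : 𝒢.delta ≠ 1) (a : G) :
    𝒢.raiser a ∈ 𝒢.pos ∧ ∀ w ∈ 𝒢.pos, 𝒢.RightGE w (𝒢.raiser a) ↔
      𝒢.RightGE w (𝒢.delta ^ (𝒢.inf a + 1) * a⁻¹) := by
  have hb := 𝒢.zpow_neg_inf_mul_mem hΔ a
  obtain ⟨hs, hsb⟩ := 𝒢.leftGcd_delta_spec hb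
  have hgcd := 𝒢.leftLE_leftGcd 𝒢.delta_mem_pos hb
  have hr : 𝒢.raiser a = 𝒢.delta * ((𝒢.tau ^ (-𝒢.inf a))
    (𝒢.leftGcd 𝒢.delta (𝒢.delta ^ (-𝒢.inf a) * a)))⁻¹ := rfl
  rw [tau_zpow_apply] at hr
  generalize 𝒢.leftGcd 𝒢.delta (𝒢.delta ^ (-𝒢.inf a) * a) = s at *
  generalize 𝒢.inf a = m at *
  rw [hr]
  have hpos := (𝒢.mem_S_iff_right.mp hs).2
  refine ⟨?_, fun w hw => ?_⟩
  · convert 𝒢.conj_zpow_mem m hpos using 1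
    group
  · have hw' := 𝒢.conj_zpow_mem (-m - 1) hw
    have h1 := hgcd (𝒢.delta ^ (-m) * w⁻¹ * 𝒢.delta ^ (m + 1))
    have e1 : 𝒢.LeftLE (𝒢.delta ^ (-m) * w⁻¹ * 𝒢.delta ^ (m + 1)) 𝒢.delta := by
      rw [leftLE_iff]
      convert hw' using 1
      group
    have e2 : 𝒢.LeftLE (𝒢.delta ^ (-m) * w⁻¹ * 𝒢.delta ^ (m + 1)) (𝒢.delta ^ (-m) * a) ↔
        𝒢.RightGE w (𝒢.delta ^ (m + 1) * a⁻¹) := by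
      rw [leftLE_iff, rightGE_iff, ← 𝒢.conj_zpow_mem_iff (m + 1)]
      convert Iff.rfl using 2
      group
    have e3 : 𝒢.LeftLE (𝒢.delta ^ (-m) * w⁻¹ * 𝒢.delta ^ (m + 1)) s ↔
        𝒢.RightGE w (𝒢.delta * (𝒢.delta ^ (- -m) * s * 𝒢.delta ^ (-m))⁻¹) := by
      rw [leftLE_iff, rightGE_iff, ← 𝒢.conj_zpow_mem_iff (m + 1)]
      convert Iff.rfl using 2
      group
    rw [← e2, ← e3, h1]
    exact and_iff_right e1

/-- The last factor is the join of 1 and Δ^{-n} a, because the product of the other factors is the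
gcd of Δ^{-inf a} a and Δ^{n - inf a}. For a = Δ^{n+1} there are no factors: the convention gives 1,
whereas the join is Δ. -/
theorem lastFactor_spec (hΔ : 𝒢.delta ≠ 1) {a : G} {n : ℤ} (hn : 𝒢.sup a = n + 1)
    (hne : a ≠ 𝒢.delta ^ (n + 1)) :
    𝒢.lastFactor a ∈ 𝒢.pos ∧ ∀ w ∈ 𝒢.pos, 𝒢.RightGE w (𝒢.lastFactor a) ↔
      𝒢.RightGE w (𝒢.delta ^ (-n) * a) := by
  have h := 𝒢.normalFactors_spec hΔ a
  have hsup : ∀ j, 𝒢.sup a ≤ j ↔ _ := fun j => 𝒢.sup_le_iff hΔ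
  simp only [twoSidedLE_zpow_right] at hsup
  have hsz := 𝒢.sup_zpow hΔ (𝒢.inf a)
  rw [lastFactor]
  generalize 𝒢.inf a = m at *
  rcases List.eq_nil_or_concat (𝒢.normalFactors a) with hl | ⟨l, t, hl⟩
  · rw [hl] at h
    have h1 : a = 𝒢.delta ^ m := by
      rw [zpow_neg] at h
      exact (inv_mul_eq_one.mp (by simpa using h.1.symm)).symm
    rw [h1] at hn hne
    exact absurd (by rw [← hn, hsz]) hne
  · rw [List.concat_eq_append] at hl
    rw [hl] at h ⊢
    have ha : a = 𝒢.delta ^ m * (l.prod * t) := by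
      have := h.1
      simp only [List.prod_append, List.prod_singleton] at this
      rw [this]; group
    have ht : t ∈ 𝒢.S := h.mem_S t (by simp)
    have ht1 : t ≠ 1 := by simpa using h.2.2 (by simp)
    have htp := (𝒢.mem_S_iff_left.mp ht).1
    have hlS : ∀ s ∈ l, s ∈ 𝒢.S := fun s hs => h.mem_S s (by simp [hs])
    have htake : ∀ {d}, 𝒢.LeftLE d (𝒢.delta ^ (-m) * a) → 𝒢.LeftLE d (𝒢.delta ^ l.length) →
        𝒢.LeftLE d l.prod := fun hd hd' => by
      simpa using h.leftLE_prod_take l.length hd hd'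
    -- The number of factors is sup a - inf a: if it were larger, the whole product would divide the
    -- product without its last factor t, forcing t = 1.
    have hnm : n = m + l.length := by
      refine le_antisymm ?_ ?_
      · have : 𝒢.sup a ≤ m + l.length + 1 := by
          rw [hsup]
          have := 𝒢.inv_list_prod_mul_pow_mem h.mem_S
          convert this using 1
          rw [ha]
          simp [mul_assoc, zpow_add, pow_succ]
        omega
      · by_contra! hlt
        have h2 := (hsup (m + l.length)).mp (by omega)
        have h3 : 𝒢.LeftLE (l.prod * t) l.prod := htake
          (by rw [ha]; simpa using ⟨1, 𝒢.one_mem_pos, by simp⟩)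
          (by rw [leftLE_iff]; rw [ha] at h2; simpa [mul_assoc, zpow_add] using h2)
        rw [leftLE_iff] at h3
        exact ht1 (𝒢.eq_one_of_inv_mem htp (by simpa [mul_assoc] using h3))
    have hlast : (l ++ [t]).getLastD 1 = t := by simp
    rw [hlast]
    refine ⟨htp, fun w hw => ⟨fun hwt => hwt.trans ?_, fun hwa => ?_⟩⟩
    · rw [rightGE_iff, ha, hnm]
      convert 𝒢.inv_list_prod_mul_pow_mem hlS using 1
      rw [← zpow_natCast]
      group
    · have h4 : 𝒢.LeftLE (l.prod * t * w⁻¹) l.prod := by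
        refine htake ?_ ?_
        · rw [leftLE_iff, ha]
          simpa [mul_assoc] using hw
        · rw [rightGE_iff] at hwa
          rw [leftLE_iff]
          convert hwa using 1
          rw [ha, hnm, ← zpow_natCast]
          group
      rw [leftLE_iff] at h4
      rw [rightGE_iff]
      simpa [mul_assoc] using h4

end GarsideStructure
end Garside

/-! ### An abstract bound on the length of an orbit -/

namespace Garside

/-- Let `F` be an inflationary join endomorphism commuting with a shift `d`. If the intervals
`[d x, x]` contain no strict chains with `M + 2` steps, then the orbit of `o` under `F`, if it
stabilizes at all, does so after at most `M` steps. -/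
theorem iterate_stable_of_bounded_chains {X : Type*} [SemilatticeSup X] {F d : X → X} {o : X}
    {M : ℕ} (F_sup : ∀ x y, F (x ⊔ y) = F x ⊔ F y) (F_infl : ∀ x, x ≤ F x)
    (d_sup : ∀ x y, d (x ⊔ y) = d x ⊔ d y) (d_le : ∀ x, d x ≤ x) (F_d : ∀ x, F (d x) = d (F x))
    (arch : ∀ x, ∃ k, d^[k] x ≤ o)
    (hchain : ∀ x, ∀ u : ℕ → X, u 0 = d x → (∀ i < M + 2, u i < u (i + 1)) →
      ¬ u (M + 2) ≤ x)
    (hstab : ∃ N, F (F^[N] o) = F^[N] o) : F (F^[M] o) = F^[M] o := by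
  obtain ⟨N, hN⟩ := hstab
  have F_mono : Monotone F := fun x y h => by
    have := F_sup x y
    rw [sup_eq_right.mpr h] at this
    rw [this]; exact le_sup_left
  have hmono : Monotone fun n => F^[n] o := monotone_nat_of_le_succ fun n => by
    rw [Function.iterate_succ_apply']; exact F_infl _
  set x := F^[N] o with hx
  -- The limit x is the least fixed point above o.
  have hle : ∀ {w}, o ≤ w → F w = w → ∀ n, F^[n] o ≤ w := fun {w} how hw n => by
    have := F_mono.iterate n how
    rwa [Function.iterate_fixed hw] at this
  have hox : o ≤ x := hmono (Nat.zero_le N)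
  have hdx : F (d x) = d x := by rw [F_d, hN]
  -- As d x is fixed, joining with it gives an orbit of F inside [d x, x].
  set z : ℕ → X := fun n => F^[n] o ⊔ d x with hz
  have hzF : ∀ n, F (z n) = z (n + 1) := fun n => by
    simp only [hz, F_sup, hdx, Function.iterate_succ_apply']
  have hzx : ∀ n, z n ≤ x := fun n => sup_le (hle hox hN n) (d_le x)
  have hzN : z N = x := le_antisymm (hzx N) le_sup_left
  -- If x = Fⁿ o ⊔ d x, substituting this equation into itself gives x ≤ Fⁿ o ⊔ d^k x for all k, and
  -- d^k x ≤ o for some k.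
  have hback : ∀ n, z n = x → F^[n] o = x := fun n hn => by
    refine le_antisymm (hle hox hN n) ?_
    have key : ∀ k, x ≤ F^[n] o ⊔ d^[k] x := fun k => by
      induction k with
      | zero => exact le_sup_right
      | succ k ih =>
        have h1 : d^[k] x ≤ F^[n] o ⊔ d^[k + 1] x := by
          have hdk : ∀ (k : ℕ) (a b : X), d^[k] (a ⊔ b) = d^[k] a ⊔ d^[k] b := fun k => by
            induction k with
            | zero => simp
            | succ k ih => intro a b; simp [d_sup, ih]
          have hdl : ∀ (k : ℕ) (a : X), d^[k] a ≤ a := fun k => by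
            induction k with
            | zero => simp
            | succ k ih => intro a; rw [Function.iterate_succ_apply]; exact (ih _).trans (d_le a)
          calc d^[k] x = d^[k] (F^[n] o) ⊔ d^[k] (d x) := by rw [← hdk]; exact congrArg _ hn.symm
            _ ≤ _ := sup_le_sup (hdl k _) le_rfl
        exact ih.trans (sup_le le_sup_left h1)
    obtain ⟨k, hk⟩ := arch x
    exact (key k).trans (sup_le le_rfl (hk.trans (hmono (Nat.zero_le n))))
  by_contra hne
  -- If z n is fixed, minimality of x gives z n = x, so the original orbit has also reached x.
  have hz_lt : ∀ n ≤ M, z n < z (n + 1) := fun n hn => by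
    rw [← hzF]
    refine lt_of_le_of_ne (F_infl _) fun h => hne ?_
    have hzx' : z n = x := by
      refine le_antisymm (hzx n) ?_
      rw [← hzN]
      refine sup_le (hle (w := z n) ?_ h.symm N) le_sup_right
      exact (hmono (Nat.zero_le n)).trans le_sup_left
    have hMx : F^[M] o = x :=
      le_antisymm (hle hox hN M) ((hback n hzx').symm.le.trans (hmono hn))
    rw [hMx, hN]
  -- Equality would give o ≤ d x, so x = d x by minimality; then x = d^k x ≤ o makes o itself fixed.
  -- This strict step is the extra one in the count M + 2.
  have hz0 : d x < z 0 := by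
    refine lt_of_le_of_ne le_sup_right fun h => hne ?_
    have hod : o ≤ d x := by rw [h]; exact le_sup_left
    have hxd : d x = x := le_antisymm (d_le x) (hle hod hdx N)
    obtain ⟨k, hk⟩ := arch x
    rw [Function.iterate_fixed hxd] at hk
    have hox' : o = x := le_antisymm hox hk
    have hM : F^[M] o = x := by rw [hox', Function.iterate_fixed hN]
    rw [hM, hN]
  refine hchain x (fun i => Nat.casesOn i (d x) z) rfl (fun i hi => ?_) (hzx (M + 1))
  cases i with
  | zero => exact hz0
  | succ i => exact hz_lt i (by omega)

/-! ### The ascending map and its fixed points -/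

namespace GarsideStructure

variable {G : Type*} [Group G] (𝒢 : GarsideStructure G)

/-- The partial order on `G` by right division, as a join semilattice. -/
noncomputable abbrev rightSemilattice : SemilatticeSup G where
  le a b := 𝒢.RightGE b a
  le_refl := 𝒢.rightGE_refl
  le_trans _ _ _ h h' := h'.trans h
  le_antisymm _ _ h h' := h'.antisymm h
  sup a b := (𝒢.exists_lub_pair a b).choose
  le_sup_left a b := (((𝒢.exists_lub_pair a b).choose_spec _).mp (𝒢.rightGE_refl _)).1
  le_sup_right a b := (((𝒢.exists_lub_pair a b).choose_spec _).mp (𝒢.rightGE_refl _)).2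
  sup_le a b c h h' := ((𝒢.exists_lub_pair a b).choose_spec c).mpr ⟨h, h'⟩

variable {r : ℕ}

theorem exists_ascend (p q : Fin r → ℤ) (a : Fin r → G) (y : G) :
    ∃ m, ∀ w, 𝒢.RightGE w m ↔ 𝒢.RightGE w y ∧ ∀ k,
      𝒢.RightGE w (𝒢.delta ^ p k * y * (a k)⁻¹) ∧ 𝒢.RightGE w (𝒢.delta ^ (-q k) * y * a k) := by
  obtain ⟨m, hm⟩ := 𝒢.exists_lub (T := Set.range (fun k => 𝒢.delta ^ p k * y * (a k)⁻¹) ∪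
    Set.range (fun k => 𝒢.delta ^ (-q k) * y * a k))
    ((Set.finite_range _).union (Set.finite_range _)) y
  refine ⟨m, fun w => ?_⟩
  rw [hm]
  simp only [Set.mem_union, or_imp, forall_and, Set.forall_mem_range]

/-- The join of `y` and of all the `Δ ^ p_k y a_k⁻¹` and `Δ ^ (-q_k) y a_k`. Its fixed points are the
`y` conjugating `a` into `[p, q]` from the left. -/
noncomputable def ascend (p q : Fin r → ℤ) (a : Fin r → G) (y : G) : G :=
  (𝒢.exists_ascend p q a y).choose

theorem rightGE_ascend (p q : Fin r → ℤ) (a : Fin r → G) (y w : G) :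
    𝒢.RightGE w (𝒢.ascend p q a y) ↔ 𝒢.RightGE w y ∧ ∀ k,
      𝒢.RightGE w (𝒢.delta ^ p k * y * (a k)⁻¹) ∧ 𝒢.RightGE w (𝒢.delta ^ (-q k) * y * a k) :=
  (𝒢.exists_ascend p q a y).choose_spec w

variable (p q : Fin r → ℤ) (a : Fin r → G)

theorem ascend_rightGE (y : G) : 𝒢.RightGE (𝒢.ascend p q a y) y :=
  ((𝒢.rightGE_ascend p q a y _).mp (𝒢.rightGE_refl _)).1

/-- Moving the translations onto `w` leaves only upper bounds of `y` itself on the right, whence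
monotonicity and preservation of joins. -/
theorem rightGE_ascend' (y w : G) :
    𝒢.RightGE w (𝒢.ascend p q a y) ↔ 𝒢.RightGE w y ∧ ∀ k,
      𝒢.RightGE (𝒢.delta ^ (-p k) * w * a k) y ∧
        𝒢.RightGE (𝒢.delta ^ q k * w * (a k)⁻¹) y := by
  simp only [rightGE_ascend, rightGE_zpow_mul, neg_neg, inv_inv]

theorem ascend_zpow_mul (n : ℤ) (y : G) :
    𝒢.ascend p q a (𝒢.delta ^ n * y) = 𝒢.delta ^ n * 𝒢.ascend p q a y := by
  refine eq_of_forall_rightGE_iff (𝒢 := 𝒢) fun w => ?_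
  have hw : w = 𝒢.delta ^ n * (𝒢.delta ^ (-n) * w) := by group
  generalize 𝒢.delta ^ (-n) * w = v at hw
  have h : ∀ (m : ℤ) (g : G), 𝒢.delta ^ m * (𝒢.delta ^ n * y) * g =
      𝒢.delta ^ n * (𝒢.delta ^ m * y * g) := fun m g => by
    simp only [← mul_assoc, ← zpow_add, add_comm]
  rw [hw]
  simp only [h, zpow_mul_rightGE, rightGE_ascend]

theorem ascend_mono {y y' : G} (h : 𝒢.RightGE y' y) :
    𝒢.RightGE (𝒢.ascend p q a y') (𝒢.ascend p q a y) := by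
  have := (𝒢.rightGE_ascend' p q a y' _).mp (𝒢.rightGE_refl _)
  exact (𝒢.rightGE_ascend' p q a y _).mpr
    ⟨this.1.trans h, fun k => ⟨(this.2 k).1.trans h, (this.2 k).2.trans h⟩⟩

theorem ascend_iterate_mono {y y' : G} (h : 𝒢.RightGE y' y) (n : ℕ) :
    𝒢.RightGE ((𝒢.ascend p q a)^[n] y') ((𝒢.ascend p q a)^[n] y) := by
  induction n generalizing y y' with
  | zero => exact h
  | succ n ih => exact ih (𝒢.ascend_mono p q a h)

variable {p q a}

theorem conjBy_inv_apply (y : G) (k : Fin r) : conjBy a y⁻¹ k = y * a k * y⁻¹ := by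
  simp [conjBy]

theorem twoSidedLE_conj_left {n : ℤ} {y b : G} :
    𝒢.TwoSidedLE (𝒢.delta ^ n) (y * b * y⁻¹) ↔ 𝒢.RightGE y (𝒢.delta ^ n * y * b⁻¹) := by
  rw [twoSidedLE_zpow_left, rightGE_iff]
  simp [mul_assoc]

theorem twoSidedLE_conj_right {n : ℤ} {y b : G} :
    𝒢.TwoSidedLE (y * b * y⁻¹) (𝒢.delta ^ n) ↔ 𝒢.RightGE y (𝒢.delta ^ (-n) * y * b) := by
  rw [twoSidedLE_zpow_right, rightGE_iff]
  simp [mul_assoc]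

theorem conjBy_mem_interval_iff {y : G} :
    conjBy a y⁻¹ ∈ 𝒢.interval p q ↔ 𝒢.ascend p q a y = y := by
  have h : 𝒢.ascend p q a y = y ↔ 𝒢.RightGE y (𝒢.ascend p q a y) :=
    ⟨fun h => by rw [h]; exact 𝒢.rightGE_refl y,
      fun h => (𝒢.ascend_rightGE p q a y).antisymm h⟩
  rw [h, rightGE_ascend, and_iff_right (𝒢.rightGE_refl y)]
  simp only [interval, Set.mem_ofPred_eq, conjBy_inv_apply, twoSidedLE_conj_left,
    twoSidedLE_conj_right]

/-! ### The conjugating elements -/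

/-- The tuple `c` misses the target `[p, q]` by at most one in each coordinate, and the bound on a
supremum is not missed by a power of `Δ`. -/
structure IsNear (p q : Fin r → ℤ) (c : Fin r → G) : Prop where
  le_inf : ∀ k, p k - 1 ≤ 𝒢.inf (c k)
  sup_le : ∀ k, 𝒢.sup (c k) ≤ q k + 1
  ne_zpow : ∀ k, c k ≠ 𝒢.delta ^ (q k + 1)

theorem rightGE_zpow_mul_inv_of_le_inf (hΔ : 𝒢.delta ≠ 1) {w b : G} (hw : w ∈ 𝒢.pos) {n : ℤ}
    (h : n ≤ 𝒢.inf b) : 𝒢.RightGE w (𝒢.delta ^ n * b⁻¹) := by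
  rw [𝒢.le_inf_iff hΔ, twoSidedLE_zpow_left] at h
  rw [rightGE_iff]
  simpa [mul_assoc] using 𝒢.pos.mul_mem hw h

theorem rightGE_zpow_mul_of_sup_le (hΔ : 𝒢.delta ≠ 1) {w b : G} (hw : w ∈ 𝒢.pos) {n : ℤ}
    (h : 𝒢.sup b ≤ n) : 𝒢.RightGE w (𝒢.delta ^ (-n) * b) := by
  rw [𝒢.sup_le_iff hΔ, twoSidedLE_zpow_right] at h
  rw [rightGE_iff]
  simpa [mul_assoc] using 𝒢.pos.mul_mem hw h

/-- A bound that is already met imposes no condition on positive `w`, so skipping it does not change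
the join. -/
theorem innerStep_spec (hΔ : 𝒢.delta ≠ 1) {c : Fin r → G} (hc : 𝒢.IsNear p q c) {h : G}
    (hh : h ∈ 𝒢.pos) (k : Fin r) :
    𝒢.innerStep p q c h k ∈ 𝒢.pos ∧ ∀ w, 𝒢.RightGE w (𝒢.innerStep p q c h k) ↔
      𝒢.RightGE w h ∧ 𝒢.RightGE w (𝒢.delta ^ p k * (c k)⁻¹) ∧
        𝒢.RightGE w (𝒢.delta ^ (-q k) * c k) := by
  obtain ⟨h₁, hh₁, hpos₁, hspec₁⟩ : ∃ h₁, h₁ = (if 𝒢.inf (c k) < p k then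
      𝒢.leftLcm h (𝒢.raiser (c k)) else h) ∧ h₁ ∈ 𝒢.pos ∧ ∀ w, 𝒢.RightGE w h₁ ↔
      𝒢.RightGE w h ∧ 𝒢.RightGE w (𝒢.delta ^ p k * (c k)⁻¹) := by
    refine ⟨_, rfl, ?_⟩
    split_ifs with hlt
    · obtain ⟨h1, h2⟩ := 𝒢.leftLcm_spec hh (v := 𝒢.raiser (c k))
      refine ⟨h1, fun w => (h2 w).trans (and_congr_right fun hw => ?_)⟩
      have hp : p k = 𝒢.inf (c k) + 1 := by have := hc.le_inf k; omega
      rw [hp]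
      exact (𝒢.raiser_spec hΔ (c k)).2 w (hw.mem_pos hh)
    · exact ⟨hh, fun w => (and_iff_left_of_imp fun hw =>
        𝒢.rightGE_zpow_mul_inv_of_le_inf hΔ (hw.mem_pos hh) (by omega)).symm⟩
  have heq : 𝒢.innerStep p q c h k =
      if q k < 𝒢.sup (c k) then 𝒢.leftLcm h₁ (𝒢.lastFactor (c k)) else h₁ := by
    rw [hh₁]; rfl
  rw [heq]
  simp only [← and_assoc, ← hspec₁]
  split_ifs with hlt
  · obtain ⟨h1, h2⟩ := 𝒢.leftLcm_spec hpos₁ (v := 𝒢.lastFactor (c k))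
    refine ⟨h1, fun w => (h2 w).trans (and_congr_right fun hw => ?_)⟩
    exact (𝒢.lastFactor_spec hΔ (by have := hc.sup_le k; omega) (hc.ne_zpow k)).2 w
      (hw.mem_pos hpos₁)
  · exact ⟨hpos₁, fun w => (and_iff_left_of_imp fun hw =>
      𝒢.rightGE_zpow_mul_of_sup_le hΔ (hw.mem_pos hpos₁) (by omega)).symm⟩

theorem foldl_innerStep_spec (hΔ : 𝒢.delta ≠ 1) {c : Fin r → G} (hc : 𝒢.IsNear p q c)
    (l : List (Fin r)) {h : G} (hh : h ∈ 𝒢.pos) (w : G) :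
    𝒢.RightGE w (l.foldl (𝒢.innerStep p q c) h) ↔
      𝒢.RightGE w h ∧ ∀ k ∈ l, 𝒢.RightGE w (𝒢.delta ^ p k * (c k)⁻¹) ∧
        𝒢.RightGE w (𝒢.delta ^ (-q k) * c k) := by
  induction l generalizing h with
  | nil => simp
  | cons k l ih =>
    obtain ⟨h1, h2⟩ := 𝒢.innerStep_spec hΔ hc hh k
    rw [List.foldl_cons, ih h1, h2]
    simp only [List.mem_cons, forall_eq_or_imp]
    tauto

theorem rightGE_ascend_one {c : Fin r → G} (w : G) :
    𝒢.RightGE w (𝒢.ascend p q c 1) ↔ w ∈ 𝒢.pos ∧ ∀ k,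
      𝒢.RightGE w (𝒢.delta ^ p k * (c k)⁻¹) ∧ 𝒢.RightGE w (𝒢.delta ^ (-q k) * c k) := by
  simp only [rightGE_ascend, mul_one, rightGE_one]

theorem stepElement_eq (hΔ : 𝒢.delta ≠ 1) {c : Fin r → G} (hc : 𝒢.IsNear p q c) :
    𝒢.stepElement p q c = 𝒢.ascend p q c 1 := by
  refine eq_of_forall_rightGE_iff (𝒢 := 𝒢) fun w => ?_
  rw [stepElement, 𝒢.foldl_innerStep_spec hΔ hc _ 𝒢.one_mem_pos, rightGE_ascend_one, rightGE_one]
  simp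

theorem slidingElement_eq (hΔ : 𝒢.delta ≠ 1) {c : Fin r → G} (hc : 𝒢.IsNear p q c) :
    𝒢.slidingElement p q c = 𝒢.ascend p q c 1 := by
  refine eq_of_forall_rightGE_iff (𝒢 := 𝒢) fun w => ?_
  have hf₁ : {x | ∃ j, p j = 𝒢.inf (c j) + 1 ∧
      x = (𝒢.tau ^ (-p j + 1)) (𝒢.delta * (𝒢.firstFactor (c j))⁻¹)}.Finite :=
    (Set.finite_range fun j => (𝒢.tau ^ (-p j + 1)) (𝒢.delta * (𝒢.firstFactor (c j))⁻¹)).subset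
      (by rintro x ⟨j, -, rfl⟩; exact ⟨j, rfl⟩)
  have hf₂ : {x | ∃ j, q j = 𝒢.sup (c j) - 1 ∧ x = 𝒢.lastFactor (c j)}.Finite :=
    (Set.finite_range fun j => 𝒢.lastFactor (c j)).subset
      (by rintro x ⟨j, -, rfl⟩; exact ⟨j, rfl⟩)
  obtain ⟨h1, h2⟩ := 𝒢.leftLcmOf_spec hf₁
  obtain ⟨h3, h4⟩ := 𝒢.leftLcmOf_spec hf₂
  rw [slidingElement, (𝒢.leftLcm_spec h1).2, rightGE_ascend_one]
  have hpos : 𝒢.RightGE w (𝒢.leftLcmOf {x | ∃ j, p j = 𝒢.inf (c j) + 1 ∧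
      x = (𝒢.tau ^ (-p j + 1)) (𝒢.delta * (𝒢.firstFactor (c j))⁻¹)}) → w ∈ 𝒢.pos :=
    fun h => h.mem_pos h1
  by_cases hw : w ∈ 𝒢.pos
  swap
  · exact iff_of_false (fun h => hw (hpos h.1)) fun h => hw h.1
  rw [h2 w hw, h4 w hw, and_iff_right hw, forall_and]
  refine and_congr ⟨fun h k => ?_, ?_⟩ ⟨fun h k => ?_, ?_⟩
  · by_cases hk : p k ≤ 𝒢.inf (c k)
    · exact 𝒢.rightGE_zpow_mul_inv_of_le_inf hΔ hw hk
    · have hp : p k = 𝒢.inf (c k) + 1 := by have := hc.le_inf k; omega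
      have := h _ ⟨k, hp, rfl⟩
      rw [hp, show -(𝒢.inf (c k) + 1) + 1 = -𝒢.inf (c k) by ring, ← 𝒢.raiser_eq_tau hΔ] at this
      rw [hp]
      exact ((𝒢.raiser_spec hΔ (c k)).2 w hw).mp this
  · rintro h x ⟨k, hp, rfl⟩
    have := h k
    rw [hp] at this ⊢
    rw [show -(𝒢.inf (c k) + 1) + 1 = -𝒢.inf (c k) by ring, ← 𝒢.raiser_eq_tau hΔ]
    exact ((𝒢.raiser_spec hΔ (c k)).2 w hw).mpr this
  · by_cases hk : 𝒢.sup (c k) ≤ q k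
    · exact 𝒢.rightGE_zpow_mul_of_sup_le hΔ hw hk
    · have hq : 𝒢.sup (c k) = q k + 1 := by have := hc.sup_le k; omega
      exact ((𝒢.lastFactor_spec hΔ hq (hc.ne_zpow k)).2 w hw).mp (h _ ⟨k, by omega, rfl⟩)
  · rintro h x ⟨k, hq, rfl⟩
    exact ((𝒢.lastFactor_spec hΔ (by omega) (hc.ne_zpow k)).2 w hw).mpr (h k)

/-- Right translation by `y` is an order automorphism; this turns one step of the algorithm at the
current tuple into one step of the orbit for `a`. -/
theorem ascend_conjBy_one_mul (y : G) :
    𝒢.ascend p q (conjBy a y⁻¹) 1 * y = 𝒢.ascend p q a y := by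
  refine eq_of_forall_rightGE_iff (𝒢 := 𝒢) fun w => ?_
  have hw : w = w * y⁻¹ * y := by group
  generalize w * y⁻¹ = v at hw
  have h₁ : ∀ k, 𝒢.delta ^ p k * y * (a k)⁻¹ =
      𝒢.delta ^ p k * (conjBy a y⁻¹ k)⁻¹ * y := fun k => by
    simp [conjBy, mul_assoc]
  have h₂ : ∀ k, 𝒢.delta ^ (-q k) * y * a k =
      𝒢.delta ^ (-q k) * conjBy a y⁻¹ k * y := fun k => by
    simp [conjBy, mul_assoc]
  have h₃ : 𝒢.RightGE (v * y) y ↔ v ∈ 𝒢.pos := by simp [rightGE_iff]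
  rw [hw, mul_rightGE_mul, rightGE_ascend_one, rightGE_ascend, h₃]
  simp only [h₁, h₂, mul_rightGE_mul]

/-! ### The orbit of the identity -/

theorem isNear_iterate (hΔ : 𝒢.delta ≠ 1) (h1 : 𝒢.RightGE 𝒢.delta (𝒢.ascend p q a 1))
    (hne : (conjClass a ∩ 𝒢.interval p q).Nonempty) (n : ℕ) :
    𝒢.IsNear p q (conjBy a ((𝒢.ascend p q a)^[n] 1)⁻¹) := by
  set y := (𝒢.ascend p q a)^[n] 1 with hy
  have hcomm : (𝒢.ascend p q a)^[n] 𝒢.delta = 𝒢.delta * y := by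
    have h : Function.Commute (𝒢.ascend p q a) (𝒢.delta * ·) := fun x => by
      simpa using 𝒢.ascend_zpow_mul p q a 1 x
    simpa using (h.iterate_left n) 1
  -- Applying the n-th iterate to F(1) ⊑ Δ gives F(y) ⊑ Δ y; the bounds on infima and suprema are
  -- its components.
  have hdef : 𝒢.RightGE (𝒢.delta * y) (𝒢.ascend p q a y) := by
    rw [← hcomm, hy, ← Function.iterate_succ_apply' (𝒢.ascend p q a), Function.iterate_succ_apply]
    exact 𝒢.ascend_iterate_mono p q a h1 n
  have hdef' := (𝒢.rightGE_ascend p q a y _).mp hdef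
  refine ⟨fun k => ?_, fun k => ?_, fun k hk => ?_⟩
  · rw [𝒢.le_inf_iff hΔ, conjBy_inv_apply, twoSidedLE_conj_left, ← 𝒢.zpow_mul_rightGE 1]
    convert (hdef'.2 k).1 using 1 <;> group
  · rw [𝒢.sup_le_iff hΔ, conjBy_inv_apply, twoSidedLE_conj_right, ← 𝒢.zpow_mul_rightGE 1]
    convert (hdef'.2 k).2 using 1 <;> group
  -- Otherwise the k-th entry of the conjugate in the target would be conjugate to Δ^{q_k+1}, with
  -- supremum at least q_k + 1.
  · obtain ⟨b, ⟨g, rfl⟩, hb⟩ := hne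
    have hsup := (𝒢.sup_le_iff hΔ).mpr (hb k).2
    rw [conjBy_inv_apply] at hk
    have ha : conjBy a g k = (g⁻¹ * y⁻¹) * 𝒢.delta ^ (q k + 1) * (g⁻¹ * y⁻¹)⁻¹ := by
      rw [← hk, conjBy]; group
    have := 𝒢.le_sup_conj_zpow hΔ (g⁻¹ * y⁻¹) (q k + 1)
    rw [← ha] at this
    omega

theorem sliding_iterate (hΔ : 𝒢.delta ≠ 1) (h1 : 𝒢.RightGE 𝒢.delta (𝒢.ascend p q a 1))
    (hne : (conjClass a ∩ 𝒢.interval p q).Nonempty) (n : ℕ) :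
    (𝒢.sliding p q)^[n] a = conjBy a ((𝒢.ascend p q a)^[n] 1)⁻¹ := by
  induction n with
  | zero => funext k; simp [conjBy]
  | succ n ih =>
    rw [Function.iterate_succ_apply', ih, sliding,
      𝒢.slidingElement_eq hΔ (𝒢.isNear_iterate hΔ h1 hne n), Function.iterate_succ_apply',
      ← 𝒢.ascend_conjBy_one_mul ((𝒢.ascend p q a)^[n] 1)]
    funext k
    simp [conjBy, mul_assoc]

/-- The early exit is harmless: the tuple lies in the target exactly when the orbit has become
constant. -/
theorem conjLoop_eq (hΔ : 𝒢.delta ≠ 1) (h1 : 𝒢.RightGE 𝒢.delta (𝒢.ascend p q a 1))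
    (hne : (conjClass a ∩ 𝒢.interval p q).Nonempty) (n m : ℕ) :
    𝒢.conjLoop p q n ((𝒢.ascend p q a)^[m] 1) (conjBy a ((𝒢.ascend p q a)^[m] 1)⁻¹) =
      (𝒢.ascend p q a)^[m + n] 1 := by
  induction n generalizing m with
  | zero => rfl
  | succ n ih =>
    rw [conjLoop]
    split_ifs with h
    · rw [conjBy_mem_interval_iff] at h
      rw [add_comm, Function.iterate_add_apply, Function.iterate_fixed h]
    · rw [𝒢.stepElement_eq hΔ (𝒢.isNear_iterate hΔ h1 hne m)]
      have := ih (m + 1)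
      rw [Function.iterate_succ_apply', ← 𝒢.ascend_conjBy_one_mul ((𝒢.ascend p q a)^[m] 1)] at this
      rw [show m + (n + 1) = m + 1 + n by ring, ← this]
      congr 1
      funext k
      simp [conjBy, mul_assoc]

/-! ### Stabilization within ‖Δ‖ - 1 steps -/

theorem exists_iterate_fixed (hne : (conjClass a ∩ 𝒢.interval p q).Nonempty) :
    ∃ N, 𝒢.ascend p q a ((𝒢.ascend p q a)^[N] 1) = (𝒢.ascend p q a)^[N] 1 := by
  obtain ⟨b, ⟨g, rfl⟩, hb⟩ := hne
  rw [← inv_inv g, conjBy_mem_interval_iff] at hb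
  -- A power of Δ makes the fixed point positive and keeps it fixed, so it bounds the orbit of 1,
  -- which the norm then forces to stop.
  obtain ⟨n, hn⟩ := 𝒢.exists_mul_pow_mem g⁻¹
  rw [← zpow_natCast, ← 𝒢.zpow_mul_mem_iff] at hn
  have hfix : 𝒢.ascend p q a (𝒢.delta ^ (n : ℤ) * g⁻¹) = 𝒢.delta ^ (n : ℤ) * g⁻¹ := by
    rw [ascend_zpow_mul, hb]
  generalize 𝒢.delta ^ (n : ℤ) * g⁻¹ = x at hn hfix
  by_contra! hN
  have := 𝒢.chain_length_le_norm (u := fun n => (𝒢.ascend p q a)^[n] 1) (n := 𝒢.norm x + 1)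
    (x := x) (fun i _ => ?_) ?_
  · simp at this
  · simp only [Function.iterate_succ_apply']
    exact ⟨𝒢.ascend_rightGE p q a _, (hN i).symm⟩
  · have := 𝒢.ascend_iterate_mono p q a (𝒢.rightGE_one.mpr hn) (𝒢.norm x + 1)
    rwa [Function.iterate_fixed hfix] at this

theorem iterate_norm_fixed (hne : (conjClass a ∩ 𝒢.interval p q).Nonempty) :
    𝒢.ascend p q a ((𝒢.ascend p q a)^[𝒢.norm 𝒢.delta - 1] 1) =
      (𝒢.ascend p q a)^[𝒢.norm 𝒢.delta - 1] 1 := by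
  let _ := 𝒢.rightSemilattice
  have le_def : ∀ x y : G, x ≤ y ↔ 𝒢.RightGE y x := fun _ _ => Iff.rfl
  have sup_def : ∀ x y w : G, 𝒢.RightGE w (x ⊔ y) ↔ 𝒢.RightGE w x ∧ 𝒢.RightGE w y :=
    fun x y w => _root_.sup_le_iff (a := x) (b := y) (c := w)
  -- The shift is left multiplication by Δ⁻¹. With M = ‖Δ‖ - 1, a chain with M + 2 steps would
  -- exceed ‖Δ‖, even if the subtraction truncates.
  refine iterate_stable_of_bounded_chains (d := fun x => 𝒢.delta ^ (-1 : ℤ) * x)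
    (fun x y => ?_) (𝒢.ascend_rightGE p q a) (fun x y => ?_) (fun x => ?_)
    (fun x => 𝒢.ascend_zpow_mul p q a _ x) (fun x => ?_) (fun x u h0 hu hx => ?_)
    (𝒢.exists_iterate_fixed hne)
  · refine eq_of_forall_ge_iff fun w => ?_
    rw [_root_.sup_le_iff, le_def, le_def, le_def]
    simp only [rightGE_ascend', sup_def, forall_and]
    tauto
  · refine eq_of_forall_ge_iff fun w => ?_
    have hw : w = 𝒢.delta ^ (-1 : ℤ) * (𝒢.delta * w) := by group
    generalize 𝒢.delta * w = v at hw
    subst hw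
    simp only [_root_.sup_le_iff]
    simp only [le_def, zpow_mul_rightGE]
    exact sup_def x y v
  · rw [le_def, rightGE_iff]
    simpa using 𝒢.delta_mem_pos
  · obtain ⟨n, hn⟩ := 𝒢.exists_mul_pow_mem x⁻¹
    refine ⟨n, ?_⟩
    have : ∀ k : ℕ, (fun x => 𝒢.delta ^ (-1 : ℤ) * x)^[k] x = 𝒢.delta ^ (-k : ℤ) * x := fun k => by
      rw [mul_left_iterate]
      simp
    rw [this, le_def, rightGE_iff]
    simpa using hn
  · have := 𝒢.chain_length_le_norm (u := u)
      (fun i hi => ⟨(hu i hi).le, (hu i hi).ne⟩) hx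
    rw [h0] at this
    have e : x * (𝒢.delta ^ (-1 : ℤ) * x)⁻¹ = 𝒢.delta := by group
    rw [e] at this
    omega

theorem ascend_one_le_delta {p₀ q₀ : Fin r → ℤ} (ha : a ∈ 𝒢.interval p₀ q₀)
    (hp : ∀ k, p k - 1 ≤ p₀ k) (hq : ∀ k, q₀ k ≤ q k + 1) :
    𝒢.RightGE 𝒢.delta (𝒢.ascend p q a 1) := by
  rw [rightGE_ascend_one]
  refine ⟨𝒢.delta_mem_pos, fun k => ?_⟩
  obtain ⟨h1, h2⟩ := ha k
  rw [twoSidedLE_zpow_left] at h1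
  rw [twoSidedLE_zpow_right] at h2
  rw [rightGE_iff, rightGE_iff]
  obtain ⟨i, hi⟩ := Int.le.dest (hp k)
  obtain ⟨j, hj⟩ := Int.le.dest (hq k)
  constructor
  · have h := 𝒢.pos.mul_mem h1 (𝒢.delta_pow_mem i)
    rw [← zpow_natCast, ← 𝒢.conj_zpow_mem_iff 1] at h
    convert h using 1
    rw [← hi]; group
  · have h := 𝒢.pos.mul_mem h2 (𝒢.delta_pow_mem j)
    rw [← zpow_natCast, ← 𝒢.conj_zpow_mem_iff 1] at h
    convert h using 1
    rw [show q k = q₀ k + j - 1 by omega]; group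

theorem subsingleton_of_delta_eq_one (hΔ : 𝒢.delta = 1) : Subsingleton G := by
  refine ⟨fun x y => ?_⟩
  have h : ∀ g : G, g = 1 := fun g => by
    obtain ⟨n, hn⟩ := 𝒢.exists_mul_pow_mem g
    obtain ⟨m, hm⟩ := 𝒢.exists_mul_pow_mem g⁻¹
    simp only [hΔ, one_pow, mul_one] at hn hm
    exact 𝒢.eq_one_of_inv_mem hn hm
  rw [h x, h y]

end GarsideStructure

end Garside

theorem mainTheorem1 {G : Type*} [Group G] (𝒢 : Garside.GarsideStructure G) {r : ℕ}
    (p q : Fin r → ℤ) (a : Fin r → G) (ha : a ∈ 𝒢.interval p q)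
    (i : Fin r) (p' q' : Fin r → ℤ)
    (hpq : (p' = p + Pi.single i 1 ∧ q' = q) ∨ (p' = p ∧ q' = q - Pi.single i 1))
    (hne : (Garside.conjClass a ∩ 𝒢.interval p' q').Nonempty) :
    Garside.conjBy a (𝒢.conjToInterval a p' q' (𝒢.norm 𝒢.delta - 1))⁻¹ ∈ 𝒢.interval p' q' ∧
      (𝒢.sliding p' q')^[𝒢.norm 𝒢.delta - 1] a ∈ 𝒢.interval p' q' := by
  -- For Δ = 1 the group is trivial and `inf`, `sup` carry no information, but all tuples coincide.
  by_cases hΔ : 𝒢.delta = 1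
  · have := 𝒢.subsingleton_of_delta_eq_one hΔ
    obtain ⟨b, -, hb⟩ := hne
    have hall : ∀ c, c ∈ 𝒢.interval p' q' := fun c => by rwa [Subsingleton.elim c b]
    exact ⟨hall _, hall _⟩
  have hsingle : ∀ k, 0 ≤ (Pi.single i 1 : Fin r → ℤ) k ∧ (Pi.single i 1 : Fin r → ℤ) k ≤ 1 :=
    fun k => by
      rcases eq_or_ne k i with rfl | h
      · simp
      · simp [Pi.single_eq_of_ne h]
  have h1 : 𝒢.RightGE 𝒢.delta (𝒢.ascend p' q' a 1) := by
    refine 𝒢.ascend_one_le_delta ha (fun k => ?_) (fun k => ?_) <;>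
    · have := hsingle k
      rcases hpq with ⟨rfl, rfl⟩ | ⟨rfl, rfl⟩ <;> try simp only [Pi.add_apply, Pi.sub_apply]
      all_goals omega
  have hfix := 𝒢.conjBy_mem_interval_iff.mpr (𝒢.iterate_norm_fixed hne)
  refine ⟨?_, ?_⟩
  · have h := 𝒢.conjLoop_eq hΔ h1 hne (𝒢.norm 𝒢.delta - 1) 0
    have ha1 : Garside.conjBy a (1 : G)⁻¹ = a := by funext k; simp [Garside.conjBy]
    rw [zero_add, Function.iterate_zero_apply, ha1] at h
    rw [Garside.GarsideStructure.conjToInterval, h]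
    exact hfix
  · rw [𝒢.sliding_iterate hΔ h1 hne]
    exact hfix
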